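/- Let $\Gamma$ be a countable discrete group acting measurably, and preserving the measure, on a standard Borel probability space $(X,\mathcal B,\mu)$. For $f\in L^\infty(X,\mu)$ (complex valued) and $\epsilon>0$ put $$\Lambda^f_\epsilon=\{s\in\Gamma:\ \|s.f-f\|_2<\epsilon\},\qquad (s.f)(x)=f(s^{-1}x),$$ where $\|\cdot\|_2$ is the norm of $L^2(X,\mu)$. A non-empty set $\Lambda\subset\Gamma$ is called *plump* if for every $\epsilon>0$ and all $t_1,\dots,t_n\in\Gamma\setminus\{e\}$ there are $m\ge 1$ and $s_1,\dots,s_m\in\Lambda$ such that $$\Big\|\frac1m\sum_{j=1}^m\lambda(s_jt_is_j^{-1})\Big\|<\epsilon\qquad(i=1,\dots,n),$$ where $\lambda$ is the left regular representation of $\Gamma$ on $\ell^2(\Gamma)$ and the norm is the operator norm. Let $L^\infty(X,\mu)\rtimes\Gamma$ be the von Neumann algebra on $\ell^2(\Gamma,L^2(X,\mu))$ generated by the operators $(\lambda(s)\xi)(t)=\xi(s^{-1}t)$, $s\in\Gamma$, and $(\sigma(f)\xi)(t)=(t^{-1}.f)\,\xi(t)$, $f\in L^\infty(X,\mu)$,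 and let $L(\Gamma)$ be its von Neumann subalgebra generated by $\lambda(\Gamma)$. A *factor* of $(X,\mu,\Gamma)$ is a standard Borel probability space $(Y,\eta)$ with a measurable measure preserving action of $\Gamma$, together with a measurable map $\pi:X\to Y$ such that $\pi_*\mu=\eta$ and, for every $s\in\Gamma$, $\pi(sx)=s\,\pi(x)$ for $\mu$-almost every $x$. It gives the von Neumann subalgebra $L^\infty(Y,\eta)\rtimes\Gamma\subset L^\infty(X,\mu)\rtimes\Gamma$ generated by $\lambda(\Gamma)$ and $\{\sigma(g\circ\pi): g\in L^\infty(Y,\eta)\}$. **Theorem.** Suppose that $\Lambda^f_\epsilon$ is plump for every $f\in L^\infty(X,\mu)$ and every $\epsilon>0$. Then $L^\infty(X,\mu)\rtimes\Gamma$ is reflecting: for every von Neumann algebra $\mathcal A$ with $L(\Gamma)\subset\mathcal A\subset L^\infty(X,\mu)\rtimes\Gamma$ there is a factor $\pi:(X,\mu)\to(Y,\eta)$ of $(X,\mu,\Gamma)$ with $\mathcal A=L^\infty(Y,\eta)\rtimes\Gamma$. -/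

import Mathlib

open MeasureTheory
open scoped ENNReal

noncomputable section

/-- The von Neumann algebra generated by a set `S` of bounded operators on a Hilbert space:
the double commutant of `S ∪ star S`. -/
def vonNeumannGenerated {H : Type*} [NormedAddCommGroup H] [InnerProductSpace ℂ H]
    [CompleteSpace H] (S : Set (H →L[ℂ] H)) : VonNeumannAlgebra H where
  toStarSubalgebra :=
    StarSubalgebra.centralizer ℂ (StarSubalgebra.centralizer ℂ S : Set (H →L[ℂ] H))
  centralizer_centralizer' := by simp

/-- The Hilbert space `ℓ²(Γ, E)` of square summable `E`-valued functions on `Γ`. -/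
abbrev EllTwo (Γ : Type*) (E : Type*) [NormedAddCommGroup E] : Type _ :=
  lp (fun _ : Γ => E) 2

section LeftTranslation

variable {Γ : Type*} [Group Γ] (E : Type*) [NormedAddCommGroup E] [NormedSpace ℂ E]

theorem memℓp_leftTranslate {E : Type*} [NormedAddCommGroup E] (s : Γ) (ξ : EllTwo Γ E) :
    Memℓp (fun t : Γ => ξ (s⁻¹ * t)) 2 := by
  have h := (memℓp_gen_iff (by norm_num : 0 < (2 : ℝ≥0∞).toReal)).1 (lp.memℓp ξ)
  exact memℓp_gen ((Equiv.mulLeft s⁻¹).summable_iff.2 h)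

theorem norm_leftTranslate {E : Type*} [NormedAddCommGroup E] (s : Γ) (ξ : EllTwo Γ E) :
    ‖(⟨fun t : Γ => ξ (s⁻¹ * t), memℓp_leftTranslate s ξ⟩ : EllTwo Γ E)‖ = ‖ξ‖ := by
  rw [lp.norm_eq_tsum_rpow (by norm_num), lp.norm_eq_tsum_rpow (by norm_num)]
  congr 1
  exact (Equiv.mulLeft s⁻¹).tsum_eq (fun t => ‖ξ t‖ ^ (2 : ℝ≥0∞).toReal)

/-- The left translation operator `λ(s)` on `ℓ²(Γ, E)`, `(λ(s) ξ)(t) = ξ(s⁻¹ t)`. For `E = ℂ` this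
is the left regular representation of `Γ`. -/
def leftTranslation (s : Γ) : EllTwo Γ E →L[ℂ] EllTwo Γ E :=
  (LinearIsometry.mk
    { toFun := fun ξ => ⟨fun t : Γ => ξ (s⁻¹ * t), memℓp_leftTranslate s ξ⟩
      map_add' := fun _ _ => rfl
      map_smul' := fun _ _ => rfl } (norm_leftTranslate s)).toContinuousLinearMap

/-- The von Neumann algebra generated by the operators `λ(s)`, `s ∈ Γ`, on `ℓ²(Γ, H)`. It is the
copy of the group von Neumann algebra `L(Γ)` in the algebra of bounded operators on `ℓ²(Γ, H)`. -/
def groupVonNeumann (Γ : Type*) [Group Γ] (H : Type*) [NormedAddCommGroup H]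
    [InnerProductSpace ℂ H] [CompleteSpace H] : VonNeumannAlgebra (EllTwo Γ H) :=
  vonNeumannGenerated (Set.range (leftTranslation (Γ := Γ) H))

end LeftTranslation

/-- A non-empty subset `Λ` of a (discrete) group `Γ` is plump if for every `ε > 0` and all finitely
many non-identity elements `t` of `Γ` there are `s₁, …, sₘ ∈ Λ` (with `m ≥ 1`) such that
`‖(1/m) ∑ⱼ λ(sⱼ t sⱼ⁻¹)‖ < ε` for each of these `t`, where `λ` is the left regular representation
of `Γ` on `ℓ²(Γ)` and the norm is the operator norm. -/
def IsPlump {Γ : Type*} [Group Γ] (Λ : Set Γ) : Prop :=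
  Λ.Nonempty ∧ ∀ ε : ℝ, 0 < ε → ∀ T : Finset Γ, (∀ t ∈ T, t ≠ 1) →
    ∃ (m : ℕ) (s : Fin m → Γ), 0 < m ∧ (∀ j, s j ∈ Λ) ∧
      ∀ t ∈ T, ‖(m : ℂ)⁻¹ • ∑ j, leftTranslation ℂ (s j * t * (s j)⁻¹)‖ < ε

section Dynamics

variable {Γ : Type*} [Group Γ]
  {X : Type*} [MeasurableSpace X] [MulAction Γ X] [MeasurableConstSMul Γ X]
  {μ : Measure X} [SMulInvariantMeasure Γ X μ]

/-- The action of `Γ` on `L^∞(X, μ)`: `(s.f)(x) = f(s⁻¹ x)`. -/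
def linftyTranslate (s : Γ) (f : Lp ℂ ∞ μ) : Lp ℂ ∞ μ :=
  Lp.compMeasurePreserving (fun x => s⁻¹ • x) (measurePreserving_smul s⁻¹ μ) f

/-- The set `Λ^f_ε` of all `s ∈ Γ` with `‖s.f - f‖₂ < ε`, the norm being that of `L²(X, μ)`. -/
def almostInvariantSet (Γ : Type*) [Group Γ] {X : Type*} [MeasurableSpace X] [MulAction Γ X]
    [MeasurableConstSMul Γ X] {μ : Measure X} [SMulInvariantMeasure Γ X μ]
    (f : Lp ℂ ∞ μ) (ε : ℝ) : Set Γ :=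
  {s | eLpNorm (linftyTranslate s f - f : Lp ℂ ∞ μ) 2 μ < ENNReal.ofReal ε}

/-- The faithful representation `π` of `L^∞(X, μ)` on `L²(X, μ)` by multiplication operators. -/
def multiplicationOperator {X : Type*} [MeasurableSpace X] {μ : Measure X} (f : Lp ℂ ∞ μ) :
    Lp ℂ 2 μ →L[ℂ] Lp ℂ 2 μ :=
  (ContinuousLinearMap.mul ℂ ℂ).holderL μ ∞ 2 2 f

theorem norm_multiplicationOperator_translate_le (f : Lp ℂ ∞ μ) (t : Γ) :
    ‖multiplicationOperator (linftyTranslate t⁻¹ f)‖ ≤ ‖f‖ := by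
  refine ContinuousLinearMap.opNorm_le_bound _ (norm_nonneg _) fun g => ?_
  refine (ContinuousLinearMap.norm_holder_apply_apply_le (r := 2)
    (ContinuousLinearMap.mul ℂ ℂ) (linftyTranslate t⁻¹ f) g).trans ?_
  have h : ‖linftyTranslate t⁻¹ f‖ = ‖f‖ := Lp.norm_compMeasurePreserving f _
  rw [h, ContinuousLinearMap.opNorm_mul, one_mul]

variable (Γ) in
/-- The representation `σ` of `L^∞(X, μ)` on `ℓ²(Γ, L²(X, μ))`: `(σ(f) ξ)(t) = π(t⁻¹.f) ξ(t)`. -/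
def linftyRep (f : Lp ℂ ∞ μ) : EllTwo Γ (Lp ℂ 2 μ) →L[ℂ] EllTwo Γ (Lp ℂ 2 μ) :=
  lp.mapCLM 2 (fun t : Γ => multiplicationOperator (linftyTranslate t⁻¹ f)) (norm_nonneg f)
    (norm_multiplicationOperator_translate_le f)

variable (Γ μ) in
/-- The von Neumann crossed product `L^∞(X, μ) ⋊ Γ`, generated on `ℓ²(Γ, L²(X, μ))` by `σ(f)`,
`f ∈ L^∞(X, μ)`, and `λ(s)`, `s ∈ Γ`. -/
def crossedProduct : VonNeumannAlgebra (EllTwo Γ (Lp ℂ 2 μ)) :=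
  vonNeumannGenerated
    (Set.range (linftyRep Γ (μ := μ)) ∪ Set.range (leftTranslation (Γ := Γ) (Lp ℂ 2 μ)))

end Dynamics

/-- A (measurable, probability measure preserving) `Γ`-factor `π : (X, μ) → (Y, η)` of a
probability measure preserving system `(X, μ, Γ)`: a measure preserving action of `Γ` on a standard
Borel probability space `(Y, η)` and a map `π` with `π_* μ = η` that intertwines the two
actions almost everywhere. -/
structure MeasurableFactor (Γ : Type*) [Group Γ] {X : Type*} [MeasurableSpace X] [MulAction Γ X]
    (μ : Measure X) (Y : Type*) [MeasurableSpace Y] where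
  standardBorel : StandardBorelSpace Y
  action : MulAction Γ Y
  measurable_action : MeasurableConstSMul Γ Y
  η : Measure Y
  isProbabilityMeasure : IsProbabilityMeasure η
  invariant : SMulInvariantMeasure Γ Y η
  π : X → Y
  measurePreserving : MeasurePreserving π μ η
  equivariant : ∀ s : Γ, ∀ᵐ x ∂μ, π (s • x) = s • π x

/-- The subalgebra `L^∞(Y, η) ⋊ Γ` of `L^∞(X, μ) ⋊ Γ` that comes from a factor `X → Y`: the von
Neumann algebra generated by `σ(g ∘ π)`, `g ∈ L^∞(Y, η)`, and `λ(s)`, `s ∈ Γ`. -/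
def MeasurableFactor.crossedProduct {Γ : Type*} [Group Γ] {X : Type*} [MeasurableSpace X]
    [MulAction Γ X] [MeasurableConstSMul Γ X] {μ : Measure X} [SMulInvariantMeasure Γ X μ]
    {Y : Type*} [MeasurableSpace Y] (F : MeasurableFactor Γ μ Y) :
    VonNeumannAlgebra (EllTwo Γ (Lp ℂ 2 μ)) :=
  vonNeumannGenerated
    (Set.range (fun g : Lp ℂ ∞ F.η =>
        linftyRep Γ (Lp.compMeasurePreserving F.π F.measurePreserving g)) ∪
      Set.range (leftTranslation (Γ := Γ) (Lp ℂ 2 μ)))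

/-- The crossed product `L^∞(X, μ) ⋊ Γ` is reflecting if every von Neumann algebra `A` with
`L(Γ) ⊆ A ⊆ L^∞(X, μ) ⋊ Γ` is `L^∞(Y, η) ⋊ Γ` for some `Γ`-factor `(X, μ) → (Y, η)`. -/
def IsReflecting (Γ : Type*) [Group Γ] {X : Type*} [MeasurableSpace X] [MulAction Γ X]
    [MeasurableConstSMul Γ X] (μ : Measure X) [SMulInvariantMeasure Γ X μ] : Prop :=
  ∀ A : VonNeumannAlgebra (EllTwo Γ (Lp ℂ 2 μ)),
    groupVonNeumann Γ (Lp ℂ 2 μ) ≤ A → A ≤ crossedProduct Γ μ →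
      ∃ (Y : Type) (_ : MeasurableSpace Y) (F : MeasurableFactor Γ μ Y), A = F.crossedProduct

end

/-! Write Ω = δ_e ⊗ 1, u_s for the Koopman operators, and M for the crossed product. The operators
`rightOp` commute with M and move Ω to the vectors δ_t ⊗ f, which span a dense subspace, so c ∈ M is
determined by cΩ. The vector state of Ω is a trace on M, so ‖c*Ω‖ = ‖cΩ‖. It follows that c ∈ M lies
in a von Neumann subalgebra A as soon as cΩ lies in the closure of AΩ
(`mem_of_apply_mem_orbitClosure`). Membership in A thus becomes a question about a closed subspace
of ℓ²(Γ, L²).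

Plumpness enters once. If L(Γ) ⊂ A, that closure is stable under the conjugations δ_t ⊗ v ↦
δ_{sts⁻¹} ⊗ u_s v. Approximate aΩ by a finite sum of δ_t ⊗ g_t with g_t simple, and average over s
that almost fix every g_t. The term t = e hardly moves. For t ≠ e the average is close to (1/m) ∑
δ_{s_j t s_j⁻¹} ⊗ g_t, which is small by plumpness. Hence δ_e ⊗ (aΩ)(e) is in the closure of AΩ
(`apply_traceVector_one_mem_coefficientSpace`): the conditional expectation onto L^∞ maps A into A.
Since an almost invariant set belongs to a single function, the g_t are first coded into one integer
valued function.

The functions in A are the bounded elements of a closed Γ-invariant subspace of L², and form a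
*-algebra. The sets whose indicator is in that subspace form an invariant σ-algebra, and a dense
sequence of its bounded elements, read along orbits, maps X to a shift space. This gives the factor
(`IsInvariantAlgebra.exists_factor`). Applied to aλ(t)⁻¹, the expectation property puts every
Fourier coefficient of a ∈ A in the L²-closure of L^∞(Y), so a lies in the crossed product of the
factor (`mem_of_coefficients_mem`). -/

set_option linter.unusedSectionVars false

noncomputable section

/-! ### Multiplication operators and the inclusion of L^∞ in L². -/

section Functions

variable {X : Type*} [MeasurableSpace X] {μ : Measure X}

theorem coeFn_multiplicationOperator (f : Lp ℂ ∞ μ) (v : Lp ℂ 2 μ) :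
    multiplicationOperator f v =ᵐ[μ] fun x => f x * v x :=
  ContinuousLinearMap.coeFn_holder (r := 2) (ContinuousLinearMap.mul ℂ ℂ) f v

theorem norm_multiplicationOperator_le (f : Lp ℂ ∞ μ) : ‖multiplicationOperator f‖ ≤ ‖f‖ := by
  refine ContinuousLinearMap.opNorm_le_bound _ (norm_nonneg _) fun g => ?_
  refine (ContinuousLinearMap.norm_holder_apply_apply_le (r := 2)
    (ContinuousLinearMap.mul ℂ ℂ) f g).trans ?_
  rw [ContinuousLinearMap.opNorm_mul, one_mul]

theorem multiplicationOperator_comm (f g : Lp ℂ ∞ μ) (v : Lp ℂ 2 μ) :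
    multiplicationOperator f (multiplicationOperator g v) =
      multiplicationOperator g (multiplicationOperator f v) := by
  apply Lp.ext
  filter_upwards [coeFn_multiplicationOperator f (multiplicationOperator g v),
    coeFn_multiplicationOperator g (multiplicationOperator f v),
    coeFn_multiplicationOperator f v, coeFn_multiplicationOperator g v] with x h1 h2 h3 h4
  rw [h1, h2, h3, h4]; ring

theorem inner_multiplicationOperator_left (f : Lp ℂ ∞ μ) (v w : Lp ℂ 2 μ) :
    inner ℂ (multiplicationOperator f v) w = inner ℂ v (multiplicationOperator (star f) w) := by
  rw [L2.inner_def, L2.inner_def]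
  apply integral_congr_ae
  filter_upwards [coeFn_multiplicationOperator f v, coeFn_multiplicationOperator (star f) w,
    Lp.coeFn_star f] with x h1 h2 h3
  rw [h1, h2, h3]
  simp only [RCLike.inner_apply, Pi.star_apply, RCLike.star_def, map_mul]
  ring

variable [IsFiniteMeasure μ]

variable (μ) in
/-- The constant function `1` as an element of `L²`. -/
def oneTwo : Lp ℂ 2 μ := Lp.const 2 μ (1 : ℂ)

theorem coeFn_oneTwo : oneTwo μ =ᵐ[μ] fun _ => (1 : ℂ) := Lp.coeFn_const 2 μ (1 : ℂ)

variable (μ) in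
/-- The constant function `1` as an element of `L^∞`. -/
def oneTop : Lp ℂ ∞ μ := Lp.const ∞ μ (1 : ℂ)

theorem coeFn_oneTop : oneTop μ =ᵐ[μ] fun _ => (1 : ℂ) := Lp.coeFn_const ∞ μ (1 : ℂ)

/-- The inclusion of `L^∞` in `L²`. -/
def toTwo (f : Lp ℂ ∞ μ) : Lp ℂ 2 μ := multiplicationOperator f (oneTwo μ)

theorem coeFn_toTwo (f : Lp ℂ ∞ μ) : toTwo f =ᵐ[μ] f := by
  filter_upwards [coeFn_multiplicationOperator f (oneTwo μ), coeFn_oneTwo (μ := μ)] with x h1 h2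
  rw [toTwo, h1, h2, mul_one]

theorem toTwo_oneTop : toTwo (oneTop μ) = oneTwo μ := by
  apply Lp.ext
  filter_upwards [coeFn_toTwo (oneTop μ), coeFn_oneTop (μ := μ), coeFn_oneTwo (μ := μ)]
    with x h1 h2 h3
  rw [h1, h2, h3]

theorem multiplicationOperator_oneTop (v : Lp ℂ 2 μ) : multiplicationOperator (oneTop μ) v = v := by
  apply Lp.ext
  filter_upwards [coeFn_multiplicationOperator (oneTop μ) v, coeFn_oneTop (μ := μ)] with x h1 h2
  rw [h1, h2, one_mul]

theorem norm_oneTop_le : ‖oneTop μ‖ ≤ 1 := by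
  simpa [oneTop] using Lp.norm_const_le (p := ∞) (μ := μ) (c := (1 : ℂ))

omit [IsFiniteMeasure μ] in
/-- A measurable function that is bounded almost everywhere gives an element of `L^∞`. -/
theorem exists_ae_eq_of_bound {φ : X → ℂ} (hφ : AEStronglyMeasurable φ μ) {C : ℝ}
    (hC : ∀ᵐ x ∂μ, ‖φ x‖ ≤ C) : ∃ f : Lp ℂ ∞ μ, f =ᵐ[μ] φ :=
  ⟨(memLp_top_of_bound hφ C hC).toLp φ, MemLp.coeFn_toLp _⟩

theorem dense_range_toTwo : DenseRange (toTwo (μ := μ)) := by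
  have h := Lp.simpleFunc.dense (E := ℂ) (μ := μ) (p := 2) (by norm_num)
  refine Dense.mono ?_ h
  intro v hv
  have hv' : v ∈ Lp.simpleFunc ℂ 2 μ := hv
  obtain ⟨g, hg⟩ := hv'
  obtain ⟨C, hC⟩ := g.exists_forall_norm_le
  obtain ⟨f, hf⟩ := exists_ae_eq_of_bound (μ := μ) g.aestronglyMeasurable (.of_forall hC)
  refine ⟨f, Lp.ext ?_⟩
  have h2 : v =ᵐ[μ] g := by
    have := AEEqFun.coeFn_mk (μ := μ) g g.aestronglyMeasurable
    rw [hg] at this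
    exact this
  filter_upwards [coeFn_toTwo f, hf, h2] with x h1 h2 h3
  rw [h1, h2, h3]

end Functions

/-! ### The Koopman representation on L² and its compatibility with multiplication. -/

section Koopman

variable {Γ : Type*} [Group Γ]
  {X : Type*} [MeasurableSpace X] [MulAction Γ X] [MeasurableConstSMul Γ X]
  {μ : Measure X} [SMulInvariantMeasure Γ X μ]

variable (μ) in
/-- The Koopman representation of `Γ` on `L²(X, μ)`: `(u_s v)(x) = v(s⁻¹ x)`. -/
def koopman (s : Γ) : Lp ℂ 2 μ →ₗᵢ[ℂ] Lp ℂ 2 μ :=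
  Lp.compMeasurePreservingₗᵢ ℂ (fun x => s⁻¹ • x) (measurePreserving_smul s⁻¹ μ)

theorem coeFn_koopman (s : Γ) (v : Lp ℂ 2 μ) : koopman μ s v =ᵐ[μ] fun x => v (s⁻¹ • x) :=
  Lp.coeFn_compMeasurePreserving v (measurePreserving_smul s⁻¹ μ)

theorem coeFn_linftyTranslate (s : Γ) (f : Lp ℂ ∞ μ) :
    linftyTranslate s f =ᵐ[μ] fun x => f (s⁻¹ • x) :=
  Lp.coeFn_compMeasurePreserving f (measurePreserving_smul s⁻¹ μ)

theorem ae_smul {p : X → Prop} (s : Γ) (h : ∀ᵐ x ∂μ, p x) : ∀ᵐ x ∂μ, p (s • x) :=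
  (measurePreserving_smul s μ).quasiMeasurePreserving.ae h

theorem koopman_koopman (s t : Γ) (v : Lp ℂ 2 μ) :
    koopman μ s (koopman μ t v) = koopman μ (s * t) v := by
  apply Lp.ext
  filter_upwards [coeFn_koopman s (koopman μ t v), coeFn_koopman (s * t) v,
    ae_smul s⁻¹ (coeFn_koopman t v)] with x h1 h2 h3
  rw [h1, h2, h3, mul_inv_rev, mul_smul]

theorem koopman_one (v : Lp ℂ 2 μ) : koopman μ (1 : Γ) v = v := by
  apply Lp.ext
  filter_upwards [coeFn_koopman (1 : Γ) v] with x h1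
  rw [h1, inv_one, one_smul]

theorem linftyTranslate_linftyTranslate (s t : Γ) (f : Lp ℂ ∞ μ) :
    linftyTranslate s (linftyTranslate t f) = linftyTranslate (s * t) f := by
  apply Lp.ext
  filter_upwards [coeFn_linftyTranslate s (linftyTranslate t f), coeFn_linftyTranslate (s * t) f,
    ae_smul s⁻¹ (coeFn_linftyTranslate t f)] with x h1 h2 h3
  rw [h1, h2, h3, mul_inv_rev, mul_smul]

theorem linftyTranslate_one (f : Lp ℂ ∞ μ) : linftyTranslate (1 : Γ) f = f := by
  apply Lp.ext
  filter_upwards [coeFn_linftyTranslate (1 : Γ) f] with x h1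
  rw [h1, inv_one, one_smul]

theorem linftyTranslate_star (s : Γ) (f : Lp ℂ ∞ μ) :
    linftyTranslate s (star f) = star (linftyTranslate s f) := by
  apply Lp.ext
  filter_upwards [coeFn_linftyTranslate s (star f), coeFn_linftyTranslate s f,
    ae_smul s⁻¹ (Lp.coeFn_star f), Lp.coeFn_star (linftyTranslate s f)] with x h1 h2 h3 h4
  rw [h1, h3, h4, Pi.star_apply, Pi.star_apply, h2]

theorem koopman_multiplicationOperator (s : Γ) (f : Lp ℂ ∞ μ) (v : Lp ℂ 2 μ) :
    koopman μ s (multiplicationOperator f v) =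
      multiplicationOperator (linftyTranslate s f) (koopman μ s v) := by
  apply Lp.ext
  filter_upwards [coeFn_koopman s (multiplicationOperator f v), coeFn_linftyTranslate s f,
    ae_smul s⁻¹ (coeFn_multiplicationOperator f v), coeFn_koopman s v,
    coeFn_multiplicationOperator (linftyTranslate s f) (koopman μ s v)] with x h1 h2 h3 h4 h5
  rw [h1, h3, h5, h2, h4]

variable [IsFiniteMeasure μ]

theorem koopman_oneTwo (s : Γ) : koopman μ s (oneTwo μ) = oneTwo μ := by
  apply Lp.ext
  filter_upwards [coeFn_koopman s (oneTwo μ), coeFn_oneTwo (μ := μ),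
    ae_smul s⁻¹ (coeFn_oneTwo (μ := μ))] with x h1 h2 h3
  rw [h1, h2, h3]

theorem koopman_toTwo (s : Γ) (f : Lp ℂ ∞ μ) :
    koopman μ s (toTwo f) = toTwo (linftyTranslate s f) := by
  rw [toTwo, koopman_multiplicationOperator, koopman_oneTwo, toTwo]

end Koopman

/-! ### Elementary vectors and translations in ℓ²(Γ, E). -/

section EllTwo

variable {Γ : Type*} {E : Type*} [NormedAddCommGroup E] [NormedSpace ℂ E]

/-- The inclusion `v ↦ δ_t ⊗ v` of `E` in `ℓ²(Γ, E)`. -/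
def delta (t : Γ) : E →L[ℂ] EllTwo Γ E := 
  let _ := Classical.decEq Γ
  lp.singleContinuousLinearMap ℂ (fun _ : Γ => E) 2 t

theorem delta_apply [i : DecidableEq Γ] (t : Γ) (v : E) (r : Γ) :
    delta t v r = if r = t then v else 0 := by
  obtain rfl : i = Classical.decEq Γ := Subsingleton.elim _ _
  let _ := Classical.decEq Γ
  have : delta t v = lp.single (E := fun _ : Γ => E) 2 t v := by
    rfl
  rw [this, lp.single_apply]
  by_cases h : r = t
  · subst h; simp
  · simp [h]

theorem norm_delta (t : Γ) (v : E) : ‖delta t v‖ = ‖v‖ := by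
  classical
  exact lp.norm_single (E := fun _ : Γ => E) (p := 2) (by norm_num) t v

theorem hasSum_delta (ξ : EllTwo Γ E) : HasSum (fun t => delta t (ξ t)) ξ := by
  classical
  exact lp.hasSum_single (E := fun _ : Γ => E) (p := 2) (by norm_num) ξ

theorem inner_delta_left {E : Type*} [NormedAddCommGroup E] [InnerProductSpace ℂ E]
    (t : Γ) (v : E) (ξ : EllTwo Γ E) : inner ℂ (delta t v) ξ = inner ℂ v (ξ t) := by
  classical
  exact lp.inner_single_left (G := fun _ : Γ => E) t v ξ

/-- Two vectors of `ℓ²(Γ, E)` with the same inner products against the vectors `δ_t ⊗ v`, `v` in a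
dense set, are equal. -/
theorem ext_inner_delta {E : Type*} [NormedAddCommGroup E] [InnerProductSpace ℂ E]
    {ι : Type*} {d : ι → E} (hd : DenseRange d) {ξ ζ : EllTwo Γ E}
    (h : ∀ t i, inner ℂ (delta t (d i)) ξ = inner ℂ (delta t (d i)) ζ) : ξ = ζ := by
  apply lp.ext
  funext t
  refine hd.eq_of_inner_right (𝕜 := ℂ) fun i => ?_
  simpa only [inner_delta_left] using h t i

/-- Two bounded operators that agree on the vectors `δ_t ⊗ v`, `v` in a dense set, are equal. -/
theorem ext_delta {F : Type*} [NormedAddCommGroup F] [NormedSpace ℂ F]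
    {ι : Type*} {d : ι → E} (hd : DenseRange d) {S T : EllTwo Γ E →L[ℂ] F}
    (h : ∀ t i, S (delta t (d i)) = T (delta t (d i))) : S = T := by
  have h1 : ∀ t v, S (delta t v) = T (delta t v) := fun t v => by
    have := hd.equalizer (g := fun v => S (delta t v)) (h := fun v => T (delta t v))
      (by fun_prop) (by fun_prop) (by funext i; exact h t i)
    exact congrFun this v
  ext ξ
  have hS := (hasSum_delta ξ).mapL S
  have hT := (hasSum_delta ξ).mapL T
  simp only [h1] at hS
  exact hS.unique hT

variable [Group Γ]

theorem leftTranslation_apply (s : Γ) (ξ : EllTwo Γ E) (r : Γ) :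
    leftTranslation E s ξ r = ξ (s⁻¹ * r) := rfl

theorem leftTranslation_delta (s t : Γ) (v : E) :
    leftTranslation E s (delta t v) = delta (s * t) v := by
  classical
  apply lp.ext; funext r
  rw [leftTranslation_apply, delta_apply, delta_apply]
  simp only [inv_mul_eq_iff_eq_mul]

theorem memℓp_rightTranslate (s : Γ) (ξ : EllTwo Γ E) :
    Memℓp (fun t : Γ => ξ (t * s)) 2 := by
  have h := (memℓp_gen_iff (by norm_num : 0 < (2 : ℝ≥0∞).toReal)).1 (lp.memℓp ξ)
  exact memℓp_gen ((Equiv.mulRight s).summable_iff.2 h)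

theorem norm_rightTranslate (s : Γ) (ξ : EllTwo Γ E) :
    ‖(⟨fun t : Γ => ξ (t * s), memℓp_rightTranslate s ξ⟩ : EllTwo Γ E)‖ = ‖ξ‖ := by
  rw [lp.norm_eq_tsum_rpow (by norm_num), lp.norm_eq_tsum_rpow (by norm_num)]
  congr 1
  exact (Equiv.mulRight s).tsum_eq (fun t => ‖ξ t‖ ^ (2 : ℝ≥0∞).toReal)

variable (E) in
/-- The right translation operator on `ℓ²(Γ, E)`, `ξ ↦ ξ(· s)`. -/
def rightTranslation (s : Γ) : EllTwo Γ E →ₗᵢ[ℂ] EllTwo Γ E where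
  toFun := fun ξ => ⟨fun t : Γ => ξ (t * s), memℓp_rightTranslate s ξ⟩
  map_add' := fun _ _ => rfl
  map_smul' := fun _ _ => rfl
  norm_map' := norm_rightTranslate s

theorem star_leftTranslation {E : Type*} [NormedAddCommGroup E] [InnerProductSpace ℂ E]
    [CompleteSpace E] (s : Γ) : star (leftTranslation E s) = leftTranslation E s⁻¹ := by
  rw [ContinuousLinearMap.star_eq_adjoint, eq_comm, ContinuousLinearMap.eq_adjoint_iff]
  intro ξ ζ
  rw [lp.inner_eq_tsum, lp.inner_eq_tsum]
  rw [← (Equiv.mulLeft s).tsum_eq (fun i => inner ℂ (ξ i) (leftTranslation E s ζ i))]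
  simp [leftTranslation_apply]

end EllTwo

/-! ### The crossed product, operators in its commutant, and the trace vector. -/

section Operators

variable {Γ : Type*} [Group Γ]
  {X : Type*} [MeasurableSpace X] [MulAction Γ X] [MeasurableConstSMul Γ X]
  {μ : Measure X} [SMulInvariantMeasure Γ X μ]

theorem linftyRep_apply (f : Lp ℂ ∞ μ) (ξ : EllTwo Γ (Lp ℂ 2 μ)) (t : Γ) :
    linftyRep Γ f ξ t = multiplicationOperator (linftyTranslate t⁻¹ f) (ξ t) := rfl

theorem linftyRep_delta (f : Lp ℂ ∞ μ) (t : Γ) (v : Lp ℂ 2 μ) :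
    linftyRep Γ f (delta t v) = delta t (multiplicationOperator (linftyTranslate t⁻¹ f) v) := by
  classical
  apply lp.ext; funext r
  rw [linftyRep_apply, delta_apply, delta_apply]
  split_ifs with h
  · rw [h]
  · rw [map_zero]

theorem star_linftyRep (f : Lp ℂ ∞ μ) : star (linftyRep Γ f) = linftyRep Γ (star f) := by
  rw [ContinuousLinearMap.star_eq_adjoint, eq_comm, ContinuousLinearMap.eq_adjoint_iff]
  intro ξ ζ
  rw [lp.inner_eq_tsum, lp.inner_eq_tsum]
  refine tsum_congr fun t => ?_
  rw [linftyRep_apply, linftyRep_apply, linftyTranslate_star, inner_multiplicationOperator_left,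
    star_star]

theorem norm_multiplicationOperator_comp_koopman_le (t : Γ) (f : Lp ℂ ∞ μ) :
    ‖(multiplicationOperator f).comp (koopman μ t⁻¹).toContinuousLinearMap‖ ≤ ‖f‖ := by
  refine (ContinuousLinearMap.opNorm_comp_le _ _).trans ?_
  refine (mul_le_of_le_one_right (norm_nonneg _) ?_).trans (norm_multiplicationOperator_le f)
  exact (koopman μ t⁻¹).norm_toContinuousLinearMap_le

/-- The operators `(R ξ)(r) = f · u_t⁻¹ ξ(r t⁻¹)`. They commute with the crossed product, and send
the cyclic vector to `δ_t ⊗ f`. -/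
def rightOp (t : Γ) (f : Lp ℂ ∞ μ) : EllTwo Γ (Lp ℂ 2 μ) →L[ℂ] EllTwo Γ (Lp ℂ 2 μ) :=
  (lp.mapCLM 2
    (fun _ : Γ => (multiplicationOperator f).comp (koopman μ t⁻¹).toContinuousLinearMap)
    (norm_nonneg f) (fun _ => norm_multiplicationOperator_comp_koopman_le t f)).comp
    (rightTranslation (Lp ℂ 2 μ) t⁻¹).toContinuousLinearMap

theorem rightOp_apply (t : Γ) (f : Lp ℂ ∞ μ) (ξ : EllTwo Γ (Lp ℂ 2 μ)) (r : Γ) :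
    rightOp t f ξ r = multiplicationOperator f (koopman μ t⁻¹ (ξ (r * t⁻¹))) := rfl

theorem norm_rightOp_le (t : Γ) (f : Lp ℂ ∞ μ) : ‖rightOp t f‖ ≤ ‖f‖ := by
  refine (ContinuousLinearMap.opNorm_comp_le _ _).trans ?_
  refine (mul_le_of_le_one_right (norm_nonneg _)
    (LinearIsometry.norm_toContinuousLinearMap_le _)).trans ?_
  exact lp.norm_mapCLM_le _ _ _ _

theorem rightOp_delta (t r : Γ) (f : Lp ℂ ∞ μ) (v : Lp ℂ 2 μ) :
    rightOp t f (delta r v) = delta (r * t) (multiplicationOperator f (koopman μ t⁻¹ v)) := by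
  classical
  apply lp.ext; funext q
  rw [rightOp_apply, delta_apply, delta_apply]
  simp only [mul_inv_eq_iff_eq_mul]
  split_ifs with h
  · rfl
  · rw [map_zero, map_zero]

theorem leftTranslation_mul_rightOp (s t : Γ) (f : Lp ℂ ∞ μ) :
    leftTranslation (Lp ℂ 2 μ) s * rightOp t f = rightOp t f * leftTranslation (Lp ℂ 2 μ) s := by
  ext1 ξ
  apply lp.ext; funext r
  simp only [mul_apply_eq_comp, leftTranslation_apply, rightOp_apply, mul_assoc]

/-- The operator u_{t⁻¹} turns (r t⁻¹)⁻¹.g, the multiplier in the fibre r t⁻¹, into r⁻¹.g, the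
multiplier in the fibre r. The rest is commutativity of L^∞. -/
theorem linftyRep_mul_rightOp (g : Lp ℂ ∞ μ) (t : Γ) (f : Lp ℂ ∞ μ) :
    linftyRep Γ g * rightOp t f = rightOp t f * linftyRep Γ g := by
  ext1 ξ
  apply lp.ext; funext r
  simp only [mul_apply_eq_comp, linftyRep_apply, rightOp_apply,
    koopman_multiplicationOperator, linftyTranslate_linftyTranslate]
  rw [multiplicationOperator_comm]
  simp [mul_inv_rev]

theorem mem_vonNeumannGenerated {H : Type*} [NormedAddCommGroup H] [InnerProductSpace ℂ H]
    [CompleteSpace H] {S : Set (H →L[ℂ] H)} {a : H →L[ℂ] H} :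
    a ∈ vonNeumannGenerated S ↔
      a ∈ StarSubalgebra.centralizer ℂ (StarSubalgebra.centralizer ℂ S : Set (H →L[ℂ] H)) :=
  Iff.rfl

theorem subset_vonNeumannGenerated {H : Type*} [NormedAddCommGroup H] [InnerProductSpace ℂ H]
    [CompleteSpace H] {S : Set (H →L[ℂ] H)} {a : H →L[ℂ] H} (ha : a ∈ S) :
    a ∈ vonNeumannGenerated S := by
  rw [mem_vonNeumannGenerated, StarSubalgebra.mem_centralizer_iff]
  intro z hz
  have h := (StarSubalgebra.mem_centralizer_iff ℂ).1 (SetLike.mem_coe.1 hz)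
  refine ⟨(h a ha).1.symm, ?_⟩
  have := congrArg star (h a ha).2
  simpa [star_mul] using this

/-- The bicommutant property of A, in the form used to prove membership. -/
theorem mem_of_forall_commute {H : Type*} [NormedAddCommGroup H] [InnerProductSpace ℂ H]
    [CompleteSpace H] {A : VonNeumannAlgebra H} {c : H →L[ℂ] H}
    (h : ∀ x : H →L[ℂ] H, (∀ a ∈ A, a * x = x * a) → x * c = c * x) : c ∈ A := by
  rw [← SetLike.mem_coe, ← A.centralizer_centralizer, Set.mem_centralizer_iff]
  intro x hx
  exact h x fun a ha => Set.mem_centralizer_iff.1 hx a ha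

theorem vonNeumannGenerated_le {H : Type*} [NormedAddCommGroup H] [InnerProductSpace ℂ H]
    [CompleteSpace H] {S : Set (H →L[ℂ] H)} {A : VonNeumannAlgebra H} (h : ∀ a ∈ S, a ∈ A) :
    vonNeumannGenerated S ≤ A := by
  intro a ha
  rw [mem_vonNeumannGenerated, StarSubalgebra.mem_centralizer_iff] at ha
  refine mem_of_forall_commute fun x hx => (ha x ?_).1
  rw [SetLike.mem_coe, StarSubalgebra.mem_centralizer_iff]
  exact fun g hg => ⟨hx g (h g hg), hx _ (star_mem (h g hg))⟩

theorem commute_rightOp {c : EllTwo Γ (Lp ℂ 2 μ) →L[ℂ] EllTwo Γ (Lp ℂ 2 μ)}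
    (hc : c ∈ crossedProduct Γ μ) (t : Γ) (f : Lp ℂ ∞ μ) : rightOp t f * c = c * rightOp t f := by
  rw [crossedProduct, mem_vonNeumannGenerated, StarSubalgebra.mem_centralizer_iff] at hc
  refine (hc (rightOp t f) ?_).1
  rw [SetLike.mem_coe, StarSubalgebra.mem_centralizer_iff]
  rintro g (⟨f', rfl⟩ | ⟨s, rfl⟩)
  · rw [star_linftyRep]
    exact ⟨linftyRep_mul_rightOp _ _ _, linftyRep_mul_rightOp _ _ _⟩
  · rw [star_leftTranslation]
    exact ⟨leftTranslation_mul_rightOp _ _ _, leftTranslation_mul_rightOp _ _ _⟩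

theorem linftyRep_mem_crossedProduct (f : Lp ℂ ∞ μ) : linftyRep Γ f ∈ crossedProduct Γ μ :=
  subset_vonNeumannGenerated (Or.inl ⟨f, rfl⟩)

theorem leftTranslation_mem_groupVonNeumann (s : Γ) :
    leftTranslation (Lp ℂ 2 μ) s ∈ groupVonNeumann Γ (Lp ℂ 2 μ) :=
  subset_vonNeumannGenerated ⟨s, rfl⟩

variable [IsFiniteMeasure μ]

variable (Γ μ) in
/-- The cyclic and separating trace vector `δ_e ⊗ 1` of the crossed product. -/
def traceVector : EllTwo Γ (Lp ℂ 2 μ) := delta 1 (oneTwo μ)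

theorem rightOp_traceVector (t : Γ) (f : Lp ℂ ∞ μ) :
    rightOp t f (traceVector Γ μ) = delta t (toTwo f) := by
  rw [traceVector, rightOp_delta, one_mul, koopman_oneTwo, toTwo]

theorem linftyRep_traceVector (f : Lp ℂ ∞ μ) :
    linftyRep Γ f (traceVector Γ μ) = delta 1 (toTwo f) := by
  rw [traceVector, linftyRep_delta, inv_one, linftyTranslate_one, toTwo]

theorem leftTranslation_traceVector (s : Γ) :
    leftTranslation (Lp ℂ 2 μ) s (traceVector Γ μ) = delta s (oneTwo μ) := by
  rw [traceVector, leftTranslation_delta, mul_one]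

/-- Since δ_t ⊗ f is the image of Ω under an operator commuting with c, the single vector cΩ
determines c on a total set. -/
theorem apply_delta_toTwo {c : EllTwo Γ (Lp ℂ 2 μ) →L[ℂ] EllTwo Γ (Lp ℂ 2 μ)}
    (hc : c ∈ crossedProduct Γ μ) (t : Γ) (f : Lp ℂ ∞ μ) :
    c (delta t (toTwo f)) = rightOp t f (c (traceVector Γ μ)) := by
  rw [← rightOp_traceVector]
  exact (congrArg (fun S => S (traceVector Γ μ)) (commute_rightOp hc t f)).symm

end Operators

/-! ### Conjugation on L² and a criterion for boundedness. -/

section Functions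

variable {X : Type*} [MeasurableSpace X] {μ : Measure X}

theorem norm_star_Lp_two (v : Lp ℂ 2 μ) : ‖star v‖ = ‖v‖ := by
  apply le_antisymm <;> refine Lp.norm_le_norm_of_ae_le ?_ <;>
  · filter_upwards [Lp.coeFn_star v] with x hx
    rw [hx, Pi.star_apply, norm_star]

variable [IsFiniteMeasure μ]

theorem inner_multiplicationOperator_oneTwo (f : Lp ℂ ∞ μ) (v : Lp ℂ 2 μ) :
    inner ℂ (multiplicationOperator f v) (oneTwo μ) = inner ℂ (toTwo f) (star v) := by
  rw [L2.inner_def, L2.inner_def]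
  apply integral_congr_ae
  filter_upwards [coeFn_multiplicationOperator f v, coeFn_toTwo f, Lp.coeFn_star v,
    coeFn_oneTwo (μ := μ)] with x h1 h2 h3 h4
  rw [h1, h2, h3, h4]
  simp only [RCLike.inner_apply, Pi.star_apply, RCLike.star_def, map_mul]
  ring

/-- A vector of `L²` that is a bounded left multiplier of `L^∞ ⊂ L²` is in `L^∞`. -/
theorem exists_toTwo_eq_of_bound {v : Lp ℂ 2 μ} {C : ℝ} (hC : 0 ≤ C)
    (h : ∀ f : Lp ℂ ∞ μ, ‖multiplicationOperator f v‖ ≤ C * ‖toTwo f‖) :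
    ∃ f : Lp ℂ ∞ μ, toTwo f = v := by
  -- Testing the bound on f = 1_E gives (C + 1)‖1_E‖ ≤ ‖1_E v‖ ≤ C‖1_E‖, so E is null.
  set E : Set X := {x | C + 1 < ‖v x‖} with hE
  have hEm : MeasurableSet E :=
    measurableSet_lt measurable_const (Lp.stronglyMeasurable v).norm.measurable
  obtain ⟨f, hf⟩ := exists_ae_eq_of_bound (μ := μ) (φ := E.indicator fun _ => (1 : ℂ)) (C := 1)
    (aestronglyMeasurable_const.indicator hEm)
    (.of_forall fun x => (norm_indicator_le_norm_self _ _).trans (by simp))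
  have h1 : ‖((C + 1 : ℝ) : ℂ) • toTwo f‖ ≤ ‖multiplicationOperator f v‖ := by
    refine Lp.norm_le_norm_of_ae_le ?_
    filter_upwards [Lp.coeFn_smul ((C + 1 : ℝ) : ℂ) (toTwo f), coeFn_toTwo f, hf,
      coeFn_multiplicationOperator f v] with x h1 h2 h3 h4
    rw [h1, h4, Pi.smul_apply, h2, h3]
    by_cases hx : x ∈ E
    · have hx' : C + 1 < ‖v x‖ := hx
      simp only [Set.indicator_of_mem hx, smul_eq_mul, mul_one, one_mul, Complex.norm_real,
        Real.norm_eq_abs]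
      rw [abs_of_nonneg (by linarith)]
      exact hx'.le
    · simp [Set.indicator_of_notMem hx]
  have h2 : ‖toTwo f‖ = 0 := by
    have h3 := h1.trans (h f)
    rw [norm_smul, Complex.norm_real, Real.norm_eq_abs, abs_of_nonneg (by linarith)] at h3
    nlinarith [norm_nonneg (toTwo f)]
  rw [norm_eq_zero] at h2
  have h3 : ∀ᵐ x ∂μ, ‖v x‖ ≤ C + 1 := by
    have h4 : toTwo f =ᵐ[μ] 0 := by rw [h2]; exact Lp.coeFn_zero _ _ _
    filter_upwards [coeFn_toTwo f, hf, h4] with x h1 h2 h3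
    by_contra hx
    have hx' : x ∈ E := not_le.1 hx
    rw [h1, h2, Set.indicator_of_mem hx'] at h3
    exact one_ne_zero h3
  obtain ⟨g, hg⟩ := exists_ae_eq_of_bound (Lp.aestronglyMeasurable v) h3
  exact ⟨g, Lp.ext ((coeFn_toTwo g).trans hg)⟩

end Functions

/-! ### The trace, and membership in a subalgebra read off from the trace vector. -/

section Trace

variable {Γ : Type*} [Group Γ]
  {X : Type*} [MeasurableSpace X] [MulAction Γ X] [MeasurableConstSMul Γ X]
  {μ : Measure X} [SMulInvariantMeasure Γ X μ] [IsFiniteMeasure μ]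

/-- Pairing c*Ω with δ_t ⊗ f moves c onto that vector, giving `rightOp t f` applied to cΩ. Only its
identity coefficient f · u_{t⁻¹}((cΩ)(t⁻¹)) pairs with Ω. -/
theorem star_apply_traceVector {c : EllTwo Γ (Lp ℂ 2 μ) →L[ℂ] EllTwo Γ (Lp ℂ 2 μ)}
    (hc : c ∈ crossedProduct Γ μ) (t : Γ) :
    star c (traceVector Γ μ) t = star (koopman μ t⁻¹ (c (traceVector Γ μ) t⁻¹)) := by
  refine dense_range_toTwo.eq_of_inner_right (𝕜 := ℂ) fun f => ?_
  rw [← inner_delta_left, ContinuousLinearMap.star_eq_adjoint,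
    ContinuousLinearMap.adjoint_inner_right, apply_delta_toTwo hc, ← inner_conj_symm,
    traceVector, inner_delta_left, inner_conj_symm, rightOp_apply, one_mul,
    inner_multiplicationOperator_oneTwo]

/-- The vector state given by the trace vector is tracial. -/
theorem norm_star_apply_traceVector {c : EllTwo Γ (Lp ℂ 2 μ) →L[ℂ] EllTwo Γ (Lp ℂ 2 μ)}
    (hc : c ∈ crossedProduct Γ μ) : ‖star c (traceVector Γ μ)‖ = ‖c (traceVector Γ μ)‖ := by
  rw [lp.norm_eq_tsum_rpow (by norm_num), lp.norm_eq_tsum_rpow (by norm_num),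
    ← (Equiv.inv Γ).tsum_eq (fun i => ‖c (traceVector Γ μ) i‖ ^ (2 : ℝ≥0∞).toReal)]
  simp only [star_apply_traceVector hc, norm_star_Lp_two, LinearIsometry.norm_map, Equiv.inv_apply]

/-- The closure of `A Ω`, where `Ω` is the trace vector. -/
def orbitClosure (A : VonNeumannAlgebra (EllTwo Γ (Lp ℂ 2 μ))) :
    Submodule ℂ (EllTwo Γ (Lp ℂ 2 μ)) :=
  (Submodule.map (ContinuousLinearMap.apply ℂ (EllTwo Γ (Lp ℂ 2 μ)) (traceVector Γ μ)).toLinearMap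
    A.toStarSubalgebra.toSubalgebra.toSubmodule).topologicalClosure

theorem coe_orbitClosure (A : VonNeumannAlgebra (EllTwo Γ (Lp ℂ 2 μ))) :
    (orbitClosure A : Set (EllTwo Γ (Lp ℂ 2 μ))) =
      closure ((fun a : EllTwo Γ (Lp ℂ 2 μ) →L[ℂ] EllTwo Γ (Lp ℂ 2 μ) => a (traceVector Γ μ)) ''
        (A : Set (EllTwo Γ (Lp ℂ 2 μ) →L[ℂ] EllTwo Γ (Lp ℂ 2 μ)))) := rfl

theorem isClosed_orbitClosure (A : VonNeumannAlgebra (EllTwo Γ (Lp ℂ 2 μ))) :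
    IsClosed (orbitClosure A : Set (EllTwo Γ (Lp ℂ 2 μ))) :=
  Submodule.isClosed_topologicalClosure _

theorem apply_mem_orbitClosure {A : VonNeumannAlgebra (EllTwo Γ (Lp ℂ 2 μ))}
    {a : EllTwo Γ (Lp ℂ 2 μ) →L[ℂ] EllTwo Γ (Lp ℂ 2 μ)} (ha : a ∈ A) :
    a (traceVector Γ μ) ∈ orbitClosure A := by
  rw [← SetLike.mem_coe, coe_orbitClosure]
  exact subset_closure ⟨a, ha, rfl⟩

/-- A continuous linear map that sends `A Ω` to a closed subspace `K` sends its closure to `K`. -/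
theorem map_mem_of_mem_orbitClosure {A : VonNeumannAlgebra (EllTwo Γ (Lp ℂ 2 μ))}
    {F : Type*} [NormedAddCommGroup F] [NormedSpace ℂ F] {K : Submodule ℂ F}
    (hK : IsClosed (K : Set F)) (T : EllTwo Γ (Lp ℂ 2 μ) →L[ℂ] F)
    (hT : ∀ a ∈ A, T (a (traceVector Γ μ)) ∈ K) {ξ : EllTwo Γ (Lp ℂ 2 μ)}
    (hξ : ξ ∈ orbitClosure A) : T ξ ∈ K := by
  rw [← SetLike.mem_coe, coe_orbitClosure] at hξ
  refine closure_minimal (t := T ⁻¹' K) ?_ (hK.preimage T.continuous) hξ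
  rintro _ ⟨a, ha, rfl⟩
  exact hT a ha

/-- A von Neumann subalgebra `A` of the crossed product contains the elements `c` of the crossed
product for which `c Ω` is in the closure of `A Ω`. -/
theorem mem_of_apply_mem_orbitClosure {A : VonNeumannAlgebra (EllTwo Γ (Lp ℂ 2 μ))}
    (hA : A ≤ crossedProduct Γ μ) {c : EllTwo Γ (Lp ℂ 2 μ) →L[ℂ] EllTwo Γ (Lp ℂ 2 μ)}
    (hc : c ∈ crossedProduct Γ μ) (h : c (traceVector Γ μ) ∈ orbitClosure A) : c ∈ A := by
  refine mem_of_forall_commute fun x hx => ?_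
  refine ext_delta dense_range_toTwo fun t f => ext_inner_delta dense_range_toTwo fun s g => ?_
  rw [← SetLike.mem_coe, coe_orbitClosure, mem_closure_iff_seq_limit] at h
  obtain ⟨u, hu, hlim⟩ := h
  choose a ha hau using hu
  set v := delta t (toTwo f)
  set w := delta s (toTwo g)
  set K := ‖w‖ * (‖x‖ * ‖rightOp t f‖) + ‖rightOp s g‖ * ‖x v‖
  -- As x commutes with a n, only d = c - a n contributes. One term contains d v, which is
  -- controlled by dΩ. The other contains d* w, controlled by d*Ω, whose norm equals that of dΩ by
  -- the trace property.
  have key : ∀ n, ‖inner ℂ w ((x * c) v) - inner ℂ w ((c * x) v)‖ ≤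
      K * ‖c (traceVector Γ μ) - u n‖ := fun n => by
    have hd : c - a n ∈ crossedProduct Γ μ := sub_mem hc (hA (ha n))
    have h1 : inner ℂ w ((x * c) v) - inner ℂ w ((c * x) v) =
        inner ℂ w (x ((c - a n) v)) - inner ℂ (star (c - a n) w) (x v) := by
      have h2 : a n (x v) = x (a n v) := congrArg (fun S => S v) (hx (a n) (ha n))
      rw [ContinuousLinearMap.star_eq_adjoint, ContinuousLinearMap.adjoint_inner_left]
      simp only [mul_apply_eq_comp, sub_apply, map_sub, inner_sub_right, h2]
      ring
    have h3 : (c - a n) v = rightOp t f ((c - a n) (traceVector Γ μ)) := apply_delta_toTwo hd t f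
    have h4 : star (c - a n) w = rightOp s g (star (c - a n) (traceVector Γ μ)) :=
      apply_delta_toTwo (star_mem hd) s g
    have h5 : c (traceVector Γ μ) - u n = (c - a n) (traceVector Γ μ) := by
      rw [← hau]; rfl
    rw [h1, h3, h4, h5]
    refine (norm_sub_le _ _).trans ?_
    rw [add_mul]
    refine add_le_add ((norm_inner_le_norm _ _).trans ?_) ((norm_inner_le_norm _ _).trans ?_)
    · rw [mul_assoc, mul_assoc]
      refine mul_le_mul_of_nonneg_left (x.le_opNorm_of_le ?_) (norm_nonneg _)
      exact (rightOp t f).le_opNorm _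
    · rw [mul_right_comm]
      refine mul_le_mul_of_nonneg_right ?_ (norm_nonneg _)
      rw [← norm_star_apply_traceVector hd]
      exact (rightOp s g).le_opNorm _
  have hlim' : Filter.Tendsto (fun n => K * ‖c (traceVector Γ μ) - u n‖) Filter.atTop
      (nhds 0) := by
    have := ((tendsto_const_nhds (x := c (traceVector Γ μ))).sub hlim).norm.const_mul K
    simpa using this
  exact sub_eq_zero.1 (norm_le_zero_iff.1 (ge_of_tendsto' hlim' key))

/-- The coefficient at the identity of an element of the crossed product is in `L^∞`. -/
theorem exists_toTwo_eq_apply_traceVector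
    {a : EllTwo Γ (Lp ℂ 2 μ) →L[ℂ] EllTwo Γ (Lp ℂ 2 μ)} (ha : a ∈ crossedProduct Γ μ) :
    ∃ f : Lp ℂ ∞ μ, toTwo f = a (traceVector Γ μ) 1 := by
  refine exists_toTwo_eq_of_bound (norm_nonneg a) fun f => ?_
  -- The identity coefficient of a(δ_e ⊗ f) is f · (aΩ)(e), so multiplication by (aΩ)(e) is bounded
  -- by ‖a‖.
  have h := congrArg (fun ξ : EllTwo Γ (Lp ℂ 2 μ) => ξ 1) (apply_delta_toTwo ha 1 f)
  simp only [rightOp_apply, inv_one, mul_one, koopman_one] at h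
  rw [← h]
  refine (lp.norm_apply_le_norm (by norm_num) _ _).trans ((a.le_opNorm _).trans ?_)
  rw [norm_delta]

/-- The vectors `v ∈ L²` with `δ_e ⊗ v` in the closure of `A Ω`. -/
def coefficientSpace (A : VonNeumannAlgebra (EllTwo Γ (Lp ℂ 2 μ))) : Submodule ℂ (Lp ℂ 2 μ) :=
  (orbitClosure A).comap (delta (1 : Γ)).toLinearMap

theorem mem_coefficientSpace {A : VonNeumannAlgebra (EllTwo Γ (Lp ℂ 2 μ))} {v : Lp ℂ 2 μ} :
    v ∈ coefficientSpace A ↔ delta (1 : Γ) v ∈ orbitClosure A := Iff.rfl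

theorem isClosed_coefficientSpace (A : VonNeumannAlgebra (EllTwo Γ (Lp ℂ 2 μ))) :
    IsClosed (coefficientSpace A : Set (Lp ℂ 2 μ)) :=
  (isClosed_orbitClosure A).preimage (delta (1 : Γ)).continuous

/-- Because σ(f)Ω = δ_e ⊗ f, the functions belonging to A are exactly the bounded elements of its
coefficient space. -/
theorem linftyRep_mem_iff {A : VonNeumannAlgebra (EllTwo Γ (Lp ℂ 2 μ))}
    (hA : A ≤ crossedProduct Γ μ) {f : Lp ℂ ∞ μ} :
    linftyRep Γ f ∈ A ↔ toTwo f ∈ coefficientSpace A := by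
  rw [mem_coefficientSpace, ← linftyRep_traceVector]
  exact ⟨apply_mem_orbitClosure,
    mem_of_apply_mem_orbitClosure hA (linftyRep_mem_crossedProduct f)⟩

theorem oneTwo_mem_coefficientSpace (A : VonNeumannAlgebra (EllTwo Γ (Lp ℂ 2 μ))) :
    oneTwo μ ∈ coefficientSpace A :=
  apply_mem_orbitClosure (one_mem A)

theorem multiplicationOperator_mem_coefficientSpace
    {A : VonNeumannAlgebra (EllTwo Γ (Lp ℂ 2 μ))} {f : Lp ℂ ∞ μ} (hf : linftyRep Γ f ∈ A)
    {v : Lp ℂ 2 μ} (hv : v ∈ coefficientSpace A) :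
    multiplicationOperator f v ∈ coefficientSpace A := by
  have h := map_mem_of_mem_orbitClosure (isClosed_orbitClosure A) (linftyRep Γ f)
    (fun a ha => apply_mem_orbitClosure (mul_mem hf ha)) (mem_coefficientSpace.1 hv)
  rwa [linftyRep_delta, inv_one, linftyTranslate_one] at h

/-- The unitary operators `δ_t ⊗ v ↦ δ_{s t s⁻¹} ⊗ u_s v`, which implement the conjugation by `λ(s)`
on the trace vector. -/
def conjOp (s : Γ) : EllTwo Γ (Lp ℂ 2 μ) →L[ℂ] EllTwo Γ (Lp ℂ 2 μ) :=
  leftTranslation (Lp ℂ 2 μ) s * rightOp s⁻¹ (oneTop μ)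

theorem conjOp_delta (s t : Γ) (v : Lp ℂ 2 μ) :
    conjOp s (delta t v) = delta (s * t * s⁻¹) (koopman μ s v) := by
  rw [conjOp, mul_apply_eq_comp, rightOp_delta, multiplicationOperator_oneTop,
    leftTranslation_delta, inv_inv, mul_assoc]

theorem norm_conjOp_apply_le (s : Γ) (ξ : EllTwo Γ (Lp ℂ 2 μ)) : ‖conjOp s ξ‖ ≤ ‖ξ‖ := by
  rw [conjOp, mul_apply_eq_comp]
  refine (norm_leftTranslate s _).trans_le ?_
  refine (ContinuousLinearMap.le_of_opNorm_le _
    ((norm_rightOp_le s⁻¹ (oneTop μ)).trans norm_oneTop_le) ξ).trans_eq (one_mul _)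

/-- With R = `rightOp s⁻¹ 1`, one has λ(s⁻¹)Ω = RΩ, hence λ(s) a λ(s⁻¹)Ω = λ(s) R aΩ, and the left
side is in AΩ. -/
theorem conjOp_mem_orbitClosure {A : VonNeumannAlgebra (EllTwo Γ (Lp ℂ 2 μ))}
    (hA : A ≤ crossedProduct Γ μ) (hG : groupVonNeumann Γ (Lp ℂ 2 μ) ≤ A) (s : Γ)
    {ξ : EllTwo Γ (Lp ℂ 2 μ)} (hξ : ξ ∈ orbitClosure A) : conjOp s ξ ∈ orbitClosure A := by
  refine map_mem_of_mem_orbitClosure (isClosed_orbitClosure A) (conjOp s) (fun a ha => ?_) hξ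
  have h1 := apply_mem_orbitClosure (mul_mem (mul_mem (hG (leftTranslation_mem_groupVonNeumann s))
    ha) (hG (leftTranslation_mem_groupVonNeumann s⁻¹)))
  rwa [mul_apply_eq_comp, leftTranslation_traceVector, mul_apply_eq_comp, ← toTwo_oneTop,
    apply_delta_toTwo (hA ha), ← mul_apply_eq_comp] at h1

theorem koopman_mem_coefficientSpace {A : VonNeumannAlgebra (EllTwo Γ (Lp ℂ 2 μ))}
    (hA : A ≤ crossedProduct Γ μ) (hG : groupVonNeumann Γ (Lp ℂ 2 μ) ≤ A) (s : Γ)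
    {v : Lp ℂ 2 μ} (hv : v ∈ coefficientSpace A) : koopman μ s v ∈ coefficientSpace A := by
  have h := conjOp_mem_orbitClosure hA hG s (mem_coefficientSpace.1 hv)
  rwa [conjOp_delta, mul_one, mul_inv_cancel] at h

end Trace

/-! ### One bounded function controls the almost invariance of finitely many simple ones. -/

section AlmostInvariance

/-- Finitely many simple functions factor through one simple function with values in `ℕ`. -/
theorem exists_simpleFunc_separating {X ι β : Type*} [MeasurableSpace X] (T : Finset ι)
    (g : ι → SimpleFunc X β) :
    ∃ F : SimpleFunc X ℕ, ∀ t ∈ T, ∀ x y, F x = F y → g t x = g t y := by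
  classical
  induction T using Finset.induction_on with
  | empty => exact ⟨SimpleFunc.const X 0, by simp⟩
  | insert a T _ ih =>
    obtain ⟨F, hF⟩ := ih
    -- The pair (F, g a) has finite range, which injects into ℕ.
    obtain ⟨φ, hφ⟩ := Set.countable_iff_exists_injOn.1
      ((F.pair (g a)).range.finite_toSet.countable)
    have key : ∀ x y, φ (F x, g a x) = φ (F y, g a y) → F x = F y ∧ g a x = g a y := by
      intro x y hxy
      exact Prod.ext_iff.1 (hφ ((F.pair (g a)).mem_range_self x)
        ((F.pair (g a)).mem_range_self y) hxy)
    refine ⟨(F.pair (g a)).map φ, fun t ht x y hxy => ?_⟩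
    simp only [SimpleFunc.map_apply, SimpleFunc.pair_apply] at hxy
    rcases Finset.mem_insert.1 ht with rfl | ht
    · exact (key x y hxy).2
    · exact hF t ht x y (key x y hxy).1

variable {Γ : Type*} [Group Γ]
  {X : Type*} [MeasurableSpace X] [MulAction Γ X] [MeasurableConstSMul Γ X]
  {μ : Measure X} [SMulInvariantMeasure Γ X μ] [IsFiniteMeasure μ]

theorem norm_koopman_toTwo_sub_lt {f : Lp ℂ ∞ μ} {ε : ℝ} {s : Γ}
    (hs : s ∈ almostInvariantSet Γ f ε) : ‖koopman μ s (toTwo f) - toTwo f‖ < ε := by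
  have h : eLpNorm (koopman μ s (toTwo f) - toTwo f : Lp ℂ 2 μ) 2 μ =
      eLpNorm (linftyTranslate s f - f : Lp ℂ ∞ μ) 2 μ := by
    refine eLpNorm_congr_ae ?_
    rw [koopman_toTwo]
    filter_upwards [Lp.coeFn_sub (toTwo (linftyTranslate s f)) (toTwo f),
      Lp.coeFn_sub (linftyTranslate s f) f, coeFn_toTwo f, coeFn_toTwo (linftyTranslate s f)]
      with x h1 h2 h3 h4
    rw [h1, h2, Pi.sub_apply, Pi.sub_apply, h3, h4]
  rw [Lp.norm_def, h]
  exact (ENNReal.lt_ofReal_iff_toReal_lt (h ▸ Lp.eLpNorm_ne_top _)).1 hs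

/-- Almost invariance of finitely many simple functions follows from almost invariance of one
bounded function. -/
theorem exists_almostInvariantSet_subset {ι : Type*} (T : Finset ι) (g : ι → SimpleFunc X ℂ)
    (G : ι → Lp ℂ 2 μ) (hG : ∀ t, G t =ᵐ[μ] g t) {δ : ℝ} (hδ : 0 < δ) :
    ∃ (f : Lp ℂ ∞ μ) (ε : ℝ), 0 < ε ∧ ∀ s ∈ almostInvariantSet Γ f ε, ∀ t ∈ T,
      ‖koopman μ s (G t) - G t‖ ≤ δ := by
  obtain ⟨F, hF⟩ := exists_simpleFunc_separating T g
  obtain ⟨C, hC⟩ := (F.map (fun n : ℕ => (n : ℂ))).exists_forall_norm_le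
  obtain ⟨f, hf⟩ := exists_ae_eq_of_bound (μ := μ)
    (F.map (fun n : ℕ => (n : ℂ))).aestronglyMeasurable (.of_forall hC)
  choose B hB using fun t => (g t).exists_forall_norm_le
  -- A common bound for the oscillations of the g t. The added 1 keeps it positive when T is empty.
  set D : ℝ := ∑ t ∈ T, 2 * |B t| + 1
  have hD : 0 < D := by positivity
  refine ⟨f, δ / D, by positivity, fun s hs t ht => ?_⟩
  have hBD : 2 * B t ≤ D := by
    have h1 := Finset.single_le_sum (f := fun t => 2 * |B t|) (fun i _ => by positivity) ht
    have h2 := le_abs_self (B t)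
    linarith
  have h1 : ‖koopman μ s (G t) - G t‖ ≤ D * ‖koopman μ s (toTwo f) - toTwo f‖ := by
    refine Lp.norm_le_mul_norm_of_ae_le_mul ?_
    have hff : toTwo f =ᵐ[μ] fun x => (F x : ℂ) := (coeFn_toTwo f).trans hf
    filter_upwards [Lp.coeFn_sub (koopman μ s (toTwo f)) (toTwo f), coeFn_koopman s (toTwo f),
      hff, ae_smul s⁻¹ hff, Lp.coeFn_sub (koopman μ s (G t)) (G t), coeFn_koopman s (G t),
      hG t, ae_smul s⁻¹ (hG t)] with x h1 h2 h3 h4 h5 h6 h7 h8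
    rw [h1, h5, Pi.sub_apply, Pi.sub_apply, h2, h3, h4, h6, h7, h8]
    -- Where F does not change, neither does g t. Where it changes, the integers differ by at least
    -- 1, while g t moves by at most D.
    by_cases hx : F (s⁻¹ • x) = F x
    · rw [hF t ht _ _ hx, sub_self, norm_zero]
      positivity
    · have h9 : (1 : ℝ) ≤ ‖(F (s⁻¹ • x) : ℂ) - F x‖ := by
        have h10 : ((F (s⁻¹ • x) : ℂ) - F x) = (((F (s⁻¹ • x) : ℤ) - F x : ℤ) : ℂ) := by
          push_cast; rfl
        rw [h10, Complex.norm_intCast, ← Int.cast_abs]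
        exact_mod_cast Int.one_le_abs (sub_ne_zero.2 (Nat.cast_injective.ne hx))
      have h10 : ‖g t (s⁻¹ • x) - g t x‖ ≤ D :=
        (norm_sub_le _ _).trans (by linarith [hB t (s⁻¹ • x), hB t x])
      nlinarith
  have h2 := norm_koopman_toTwo_sub_lt hs
  calc _ ≤ _ := h1
    _ ≤ D * (δ / D) := by gcongr
    _ = δ := by field_simp

theorem exists_simpleFunc_norm_sub_lt (v : Lp ℂ 2 μ) {ε : ℝ} (hε : 0 < ε) :
    ∃ (g : SimpleFunc X ℂ) (G : Lp ℂ 2 μ), G =ᵐ[μ] g ∧ ‖v - G‖ < ε := by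
  have h := Lp.simpleFunc.dense (E := ℂ) (μ := μ) (p := 2) (by norm_num)
  obtain ⟨G, hG, hd⟩ := Metric.mem_closure_iff.1 (h v) ε hε
  have hG' : G ∈ Lp.simpleFunc ℂ 2 μ := hG
  obtain ⟨g, hg⟩ := hG'
  refine ⟨g, G, ?_, by rwa [← dist_eq_norm]⟩
  have := AEEqFun.coeFn_mk (μ := μ) g g.aestronglyMeasurable
  rwa [hg] at this

/-- Finite sums of `δ_t ⊗ g_t`, `g_t` a simple function, are dense in `ℓ²(Γ, L²)`. -/
theorem exists_sum_delta_norm_sub_lt {Γ : Type*} (ξ : EllTwo Γ (Lp ℂ 2 μ)) {ε : ℝ} (hε : 0 < ε) :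
    ∃ (T : Finset Γ) (g : Γ → SimpleFunc X ℂ) (G : Γ → Lp ℂ 2 μ), (∀ t, G t =ᵐ[μ] g t) ∧
      ‖ξ - ∑ t ∈ T, delta t (G t)‖ < ε := by
  obtain ⟨T, hT⟩ := ((Metric.tendsto_nhds.1 (hasSum_delta ξ)) (ε / 2) (by positivity)).exists
  have hpos : 0 < ε / (2 * (T.card + 1)) := by positivity
  choose g G hG hd using fun t => exists_simpleFunc_norm_sub_lt (ξ t) hpos
  refine ⟨T, g, G, hG, ?_⟩
  have h1 : ξ - ∑ t ∈ T, delta t (G t) =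
      (ξ - ∑ t ∈ T, delta t (ξ t)) + ∑ t ∈ T, delta t (ξ t - G t) := by
    simp only [map_sub, Finset.sum_sub_distrib]; abel
  have h2 : ‖∑ t ∈ T, delta t (ξ t - G t)‖ ≤ T.card * (ε / (2 * (T.card + 1))) := by
    refine (norm_sum_le_of_le T (f := fun t => delta t (ξ t - G t))
      (n := fun _ => ε / (2 * (T.card + 1))) fun t _ => ?_).trans_eq (by simp)
    rw [norm_delta]; exact (hd t).le
  have h3 : T.card * (ε / (2 * (T.card + 1))) ≤ ε / 2 := by
    rw [mul_div_assoc', div_le_div_iff₀ (by positivity) (by positivity)]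
    nlinarith
  rw [dist_comm, dist_eq_norm] at hT
  rw [h1]
  exact (norm_add_le _ _).trans_lt (by linarith)

end AlmostInvariance

/-! ### Averaging conjugates over plump sets: the conditional expectation preserves A. -/

section Averaging

theorem norm_average_le {E : Type*} [NormedAddCommGroup E] [NormedSpace ℂ E] {m : ℕ} (hm : 0 < m)
    {w : Fin m → E} {C : ℝ} (h : ∀ j, ‖w j‖ ≤ C) : ‖(m : ℂ)⁻¹ • ∑ j, w j‖ ≤ C := by
  have h1 : ‖∑ j, w j‖ ≤ m * C :=
    (norm_sum_le_of_le Finset.univ fun j _ => h j).trans_eq (by simp)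
  rw [norm_smul, norm_inv, Complex.norm_natCast]
  have : (0 : ℝ) < m := by exact_mod_cast hm
  rw [inv_mul_le_iff₀ this]
  exact h1

/-- The operator `ζ ↦ ζ ⊗ v` from `ℓ²(Γ)` to `ℓ²(Γ, E)`. -/
def tensorVector (Γ : Type*) {E : Type*} [NormedAddCommGroup E] [NormedSpace ℂ E] (v : E) :
    EllTwo Γ ℂ →L[ℂ] EllTwo Γ E :=
  lp.mapCLM 2 (fun _ : Γ => ContinuousLinearMap.toSpanSingleton ℂ v) (norm_nonneg v)
    (fun _ => (ContinuousLinearMap.norm_toSpanSingleton v).le)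

theorem tensorVector_delta {Γ E : Type*} [NormedAddCommGroup E] [NormedSpace ℂ E] (v : E) (t : Γ) :
    tensorVector Γ v (delta t (1 : ℂ)) = delta t v := by
  classical
  apply lp.ext; funext r
  change ContinuousLinearMap.toSpanSingleton ℂ v (delta t (1 : ℂ) r) = _
  rw [delta_apply, delta_apply]
  split_ifs <;> simp

/-- The vector is obtained by applying the average of the λ(r_j) to δ_e and tensoring with v. This
converts the operator norm bound of plumpness into a bound on vectors. -/
theorem norm_average_delta_le {Γ E : Type*} [Group Γ] [NormedAddCommGroup E] [NormedSpace ℂ E]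
    {m : ℕ} (r : Fin m → Γ) (v : E) :
    ‖(m : ℂ)⁻¹ • ∑ j, delta (r j) v‖ ≤ ‖(m : ℂ)⁻¹ • ∑ j, leftTranslation ℂ (r j)‖ * ‖v‖ := by
  have h : (m : ℂ)⁻¹ • ∑ j, delta (r j) v =
      tensorVector Γ v (((m : ℂ)⁻¹ • ∑ j, leftTranslation ℂ (r j)) (delta 1 (1 : ℂ))) := by
    simp [leftTranslation_delta, tensorVector_delta]
  rw [h, mul_comm]
  refine (ContinuousLinearMap.le_of_opNorm_le _ (lp.norm_mapCLM_le _ _ _ _) _).trans ?_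
  refine mul_le_mul_of_nonneg_left ((ContinuousLinearMap.le_opNorm _ _).trans_eq ?_)
    (norm_nonneg v)
  rw [norm_delta, norm_one, mul_one]

variable {Γ : Type*} [Group Γ]
  {X : Type*} [MeasurableSpace X] [MulAction Γ X] [MeasurableConstSMul Γ X]
  {μ : Measure X} [SMulInvariantMeasure Γ X μ] [IsFiniteMeasure μ]

/-- Averaging conjugates over almost invariant sets that are plump gives the coefficient at the
identity. -/
theorem exists_average_conjOp_near
    (hplump : ∀ (f : Lp ℂ ∞ μ) (ε : ℝ), 0 < ε → IsPlump (almostInvariantSet Γ f ε))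
    (ξ : EllTwo Γ (Lp ℂ 2 μ)) {ε : ℝ} (hε : 0 < ε) :
    ∃ (m : ℕ) (s : Fin m → Γ), ‖(m : ℂ)⁻¹ • ∑ j, conjOp (s j) ξ - delta 1 (ξ 1)‖ < ε := by
  classical
  -- Error budget: the tail costs less than 2 · ε/4, failure of invariance at most |T| δ ≤ ε/4, and
  -- plumpness at most ε' N ≤ ε/4.
  obtain ⟨T, g, G, hG, hT⟩ := exists_sum_delta_norm_sub_lt ξ (ε := ε / 4) (by positivity)
  set N : ℝ := ∑ t ∈ T, ‖G t‖
  have hN : 0 ≤ N := by positivity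
  set δ : ℝ := ε / (4 * (T.card + 1))
  set ε' : ℝ := ε / (4 * (N + 1))
  have hδ : 0 < δ := by positivity
  have hε' : 0 < ε' := by positivity
  obtain ⟨f, ε₀, hε₀, hf⟩ := exists_almostInvariantSet_subset (Γ := Γ) T g G hG hδ
  -- The identity is fixed by conjugation and carries the coefficient to be kept, so it is left out
  -- of the plumpness estimate.
  obtain ⟨m, s, hm, hs, hav⟩ := (hplump f ε₀ hε₀).2 ε' hε' (T.erase 1)
    (fun t ht => Finset.ne_of_mem_erase ht)
  refine ⟨m, s, ?_⟩
  have hm' : (m : ℂ) ≠ 0 := by exact_mod_cast hm.ne'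
  set D : EllTwo Γ (Lp ℂ 2 μ) →L[ℂ] EllTwo Γ (Lp ℂ 2 μ) := (m : ℂ)⁻¹ • ∑ j, conjOp (s j) -
    (delta 1).comp (lp.evalCLM ℂ (fun _ : Γ => Lp ℂ 2 μ) 2 1)
  have hDapp : ∀ ζ : EllTwo Γ (Lp ℂ 2 μ), D ζ = (m : ℂ)⁻¹ • ∑ j, conjOp (s j) ζ - delta 1 (ζ 1) :=
    fun ζ => by
      simp only [D, sub_apply, smul_apply, sum_apply,
        ContinuousLinearMap.comp_apply]
      rfl
  have hD2 : ∀ ζ, ‖D ζ‖ ≤ 2 * ‖ζ‖ := fun ζ => by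
    rw [hDapp]
    refine (norm_sub_le _ _).trans ?_
    have h1 := norm_average_le hm (w := fun j => conjOp (s j) ζ)
      (fun j => norm_conjOp_apply_le (s j) ζ)
    have h2 : ‖delta (1 : Γ) (ζ 1)‖ ≤ ‖ζ‖ := by
      rw [norm_delta]; exact lp.norm_apply_le_norm (by norm_num) _ _
    linarith
  have hDd : ∀ t ∈ T, ‖D (delta t (G t))‖ ≤ δ + ε' * ‖G t‖ := fun t ht => by
    -- Replace u_s G_t by G_t, at a cost of δ. What remains vanishes for t = e and is an average of
    -- δ_{sts⁻¹} ⊗ G_t otherwise.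
    have h1 : D (delta t (G t)) =
        (m : ℂ)⁻¹ • ∑ j, delta (s j * t * (s j)⁻¹) (koopman μ (s j) (G t) - G t) +
        ((m : ℂ)⁻¹ • ∑ j, delta (s j * t * (s j)⁻¹) (G t) - delta 1 (delta t (G t) 1)) := by
      rw [hDapp]
      simp only [conjOp_delta, map_sub, Finset.sum_sub_distrib, smul_sub]
      abel
    rw [h1]
    refine (norm_add_le _ _).trans (add_le_add (norm_average_le hm fun j => ?_) ?_)
    · rw [norm_delta]; exact hf _ (hs j) t ht
    · rw [delta_apply]
      split_ifs with h
      · subst h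
        have : (m : ℂ)⁻¹ • ∑ j, delta (s j * 1 * (s j)⁻¹) (G 1) = delta 1 (G 1) := by
          simp only [mul_one, mul_inv_cancel, Finset.sum_const, Finset.card_univ, Fintype.card_fin]
          rw [← Nat.cast_smul_eq_nsmul ℂ, smul_smul, inv_mul_cancel₀ hm', one_smul]
        rw [this, sub_self, norm_zero]
        positivity
      · rw [map_zero, sub_zero]
        refine (norm_average_delta_le _ _).trans ?_
        exact mul_le_mul_of_nonneg_right
          (hav t (Finset.mem_erase.2 ⟨Ne.symm h, ht⟩)).le (norm_nonneg _)
  rw [← hDapp]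
  have h1 : D ξ = D (ξ - ∑ t ∈ T, delta t (G t)) + ∑ t ∈ T, D (delta t (G t)) := by
    rw [map_sub, map_sum]; abel
  have h2 : ‖∑ t ∈ T, D (delta t (G t))‖ ≤ T.card * δ + ε' * N := by
    refine (norm_sum_le_of_le T hDd).trans_eq ?_
    rw [Finset.sum_add_distrib, ← Finset.mul_sum]; simp [N]
  have h3 : T.card * δ ≤ ε / 4 := by
    simp only [δ]
    rw [mul_div_assoc', div_le_div_iff₀ (by positivity) (by positivity)]
    nlinarith
  have h4 : ε' * N ≤ ε / 4 := by
    simp only [ε']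
    rw [div_mul_eq_mul_div, div_le_div_iff₀ (by positivity) (by positivity)]
    nlinarith
  have h5 := hD2 (ξ - ∑ t ∈ T, delta t (G t))
  rw [h1]
  exact (norm_add_le _ _).trans_lt (by linarith)

/-- If the almost invariant sets are plump, then the conditional expectation on `L^∞` preserves the
algebras between `L(Γ)` and the crossed product. -/
theorem apply_traceVector_one_mem_coefficientSpace
    (hplump : ∀ (f : Lp ℂ ∞ μ) (ε : ℝ), 0 < ε → IsPlump (almostInvariantSet Γ f ε))
    {A : VonNeumannAlgebra (EllTwo Γ (Lp ℂ 2 μ))}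
    (hA : A ≤ crossedProduct Γ μ) (hG : groupVonNeumann Γ (Lp ℂ 2 μ) ≤ A)
    {a : EllTwo Γ (Lp ℂ 2 μ) →L[ℂ] EllTwo Γ (Lp ℂ 2 μ)} (ha : a ∈ A) :
    a (traceVector Γ μ) 1 ∈ coefficientSpace A := by
  rw [mem_coefficientSpace, ← SetLike.mem_coe, ← (isClosed_orbitClosure A).closure_eq,
    Metric.mem_closure_iff]
  intro ε hε
  obtain ⟨m, s, h⟩ := exists_average_conjOp_near hplump (a (traceVector Γ μ)) hε
  refine ⟨_, ?_, by rw [dist_comm, dist_eq_norm]; exact h⟩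
  exact Submodule.smul_mem _ _ (Submodule.sum_mem _ fun j _ =>
    conjOp_mem_orbitClosure hA hG (s j) (apply_mem_orbitClosure ha))

end Averaging

/-! ### Polynomial approximation of the sign function. -/

section SignIteration

/-- The map `x ↦ (3x - x³)/2`, whose iterates converge to the sign on `[-1, 1]`. -/
def signStep (x : ℝ) : ℝ := (3 / 2) * x - (1 / 2) * (x * (x * x))

theorem abs_signStep_le_one {x : ℝ} (hx : |x| ≤ 1) : |signStep x| ≤ 1 := by
  rw [abs_le] at hx ⊢
  obtain ⟨h1, h2⟩ := hx
  -- This is 2(1 - signStep x), and the next product is 2(1 + signStep x).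
  have h3 : 0 ≤ (1 - x) ^ 2 * (2 + x) := mul_nonneg (sq_nonneg _) (by linarith)
  have h4 : 0 ≤ (1 + x) ^ 2 * (2 - x) := mul_nonneg (sq_nonneg _) (by linarith)
  unfold signStep
  constructor <;> nlinarith

theorem abs_iterate_signStep_le_one {x : ℝ} (hx : |x| ≤ 1) (n : ℕ) : |signStep^[n] x| ≤ 1 := by
  induction n with
  | zero => exact hx
  | succ n ih => rw [Function.iterate_succ_apply']; exact abs_signStep_le_one ih

/-- The iterates increase within [x, 1], and each step multiplies the distance to 1 by 1 - w/2 -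
w²/2 ≤ 1 - x/2, where w ≥ x is the current iterate. -/
theorem iterate_signStep_bounds {x : ℝ} (hx : 0 < x) (hx1 : x ≤ 1) (n : ℕ) :
    x ≤ signStep^[n] x ∧ signStep^[n] x ≤ 1 ∧ 1 - signStep^[n] x ≤ (1 - x / 2) ^ n := by
  induction n with
  | zero => simp [hx1, hx.le]
  | succ n ih =>
    rw [Function.iterate_succ_apply']
    obtain ⟨h1, h2, h3⟩ := ih
    set w := signStep^[n] x
    have hw : 0 < w := hx.trans_le h1
    have h4 : w ≤ signStep w := by
      have : 0 ≤ w * ((1 - w) * (1 + w)) :=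
        mul_nonneg hw.le (mul_nonneg (by linarith) (by linarith))
      unfold signStep; nlinarith
    refine ⟨h1.trans h4, (abs_le.1 (abs_signStep_le_one (abs_le.2 ⟨by linarith, h2⟩))).2, ?_⟩
    have h5 : 1 - signStep w = (1 - w) * (1 - w / 2 - w ^ 2 / 2) := by unfold signStep; ring
    have h6 : (1 - w) * (1 - w / 2 - w ^ 2 / 2) ≤ (1 - w) * (1 - x / 2) :=
      mul_le_mul_of_nonneg_left (by nlinarith [sq_nonneg w]) (by linarith)
    rw [h5, pow_succ]
    exact h6.trans (mul_le_mul_of_nonneg_right h3 (by linarith))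

theorem iterate_signStep_neg (x : ℝ) (n : ℕ) : signStep^[n] (-x) = -signStep^[n] x := by
  induction n with
  | zero => rfl
  | succ n ih =>
    rw [Function.iterate_succ_apply', Function.iterate_succ_apply', ih]
    unfold signStep; ring

theorem tendsto_iterate_signStep_of_pos {x : ℝ} (hx : 0 < x) (hx1 : x ≤ 1) :
    Filter.Tendsto (fun n => signStep^[n] x) Filter.atTop (nhds 1) := by
  have h0 : Filter.Tendsto (fun n : ℕ => 1 - (1 - x / 2) ^ n) Filter.atTop (nhds 1) := by
    simpa using (tendsto_pow_atTop_nhds_zero_of_lt_one (r := 1 - x / 2) (by linarith)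
      (by linarith)).const_sub 1
  exact tendsto_of_tendsto_of_tendsto_of_le_of_le h0 tendsto_const_nhds
    (fun n => by have := (iterate_signStep_bounds hx hx1 n).2.2; simp only; linarith)
    (fun n => (iterate_signStep_bounds hx hx1 n).2.1)

theorem tendsto_iterate_signStep {x : ℝ} (hx : |x| ≤ 1) :
    Filter.Tendsto (fun n => signStep^[n] x) Filter.atTop (nhds (Real.sign x)) := by
  obtain ⟨h1, h2⟩ := abs_le.1 hx
  rcases lt_trichotomy x 0 with h | rfl | h
  · rw [Real.sign_of_neg h]
    have := (tendsto_iterate_signStep_of_pos (x := -x) (by linarith) (by linarith)).neg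
    simpa only [iterate_signStep_neg, neg_neg] using this
  · have h0 : ∀ n, signStep^[n] 0 = 0 := fun n =>
      Function.iterate_fixed (by simp [signStep]) n
    simp [h0]
  · rw [Real.sign_of_pos h]
    exact tendsto_iterate_signStep_of_pos h h2

end SignIteration

/-! ### Functions representing elements of a closed subspace of L², and bounded convergence. -/

section Represented

variable {X : Type*} [MeasurableSpace X] {μ : Measure X}

theorem ae_norm_le_norm (f : Lp ℂ ∞ μ) : ∀ᵐ x ∂μ, ‖f x‖ ≤ ‖f‖ := by
  filter_upwards [ae_le_eLpNormEssSup (f := f) (μ := μ)] with x hx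
  rw [Lp.norm_def, eLpNorm_exponent_top]
  have h1 := ENNReal.toReal_mono ?_ hx
  · simpa using h1
  · rw [← eLpNorm_exponent_top]; exact Lp.eLpNorm_ne_top f

/-- The function `φ` represents an element of the subspace `S` of `L²`. -/
def Represents (S : Submodule ℂ (Lp ℂ 2 μ)) (φ : X → ℂ) : Prop := ∃ v ∈ S, v =ᵐ[μ] φ

namespace Represents

variable {S : Submodule ℂ (Lp ℂ 2 μ)} {φ ψ : X → ℂ}

theorem congr (h : Represents S φ) (h' : φ =ᵐ[μ] ψ) : Represents S ψ := by
  obtain ⟨v, hv, hvφ⟩ := h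
  exact ⟨v, hv, hvφ.trans h'⟩

theorem aestronglyMeasurable (h : Represents S φ) : AEStronglyMeasurable φ μ := by
  obtain ⟨v, -, hv⟩ := h
  exact (Lp.aestronglyMeasurable v).congr hv

theorem mem_of_ae_eq (h : Represents S φ) {v : Lp ℂ 2 μ} (hv : v =ᵐ[μ] φ) : v ∈ S := by
  obtain ⟨w, hw, hwφ⟩ := h
  rwa [Lp.ext (hv.trans hwφ.symm)]

theorem add (h : Represents S φ) (h' : Represents S ψ) : Represents S (fun x => φ x + ψ x) := by
  obtain ⟨v, hv, hvφ⟩ := h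
  obtain ⟨w, hw, hwψ⟩ := h'
  refine ⟨v + w, add_mem hv hw, ?_⟩
  filter_upwards [Lp.coeFn_add v w, hvφ, hwψ] with x h1 h2 h3
  rw [h1, Pi.add_apply, h2, h3]

theorem const_mul (c : ℂ) (h : Represents S φ) : Represents S (fun x => c * φ x) := by
  obtain ⟨v, hv, hvφ⟩ := h
  refine ⟨c • v, S.smul_mem c hv, ?_⟩
  filter_upwards [Lp.coeFn_smul c v, hvφ] with x h1 h2
  rw [h1, Pi.smul_apply, h2, smul_eq_mul]

theorem sub (h : Represents S φ) (h' : Represents S ψ) : Represents S (fun x => φ x - ψ x) :=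
  (h.add (h'.const_mul (-1))).congr (.of_forall fun x => by ring)

variable [IsFiniteMeasure μ]

/-- Bounded convergence: representability in a closed subspace is stable under bounded pointwise
limits. -/
theorem of_tendsto (hS : IsClosed (S : Set (Lp ℂ 2 μ))) {φ : ℕ → X → ℂ} {ψ : X → ℂ} {C : ℝ}
    (hφ : ∀ n, Represents S (φ n)) (hC : ∀ n, ∀ᵐ x ∂μ, ‖φ n x‖ ≤ C)
    (hlim : ∀ᵐ x ∂μ, Filter.Tendsto (fun n => φ n x) Filter.atTop (nhds (ψ x))) :
    Represents S ψ := by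
  have hm : ∀ n, AEStronglyMeasurable (φ n) μ := fun n => (hφ n).aestronglyMeasurable
  have hψm : AEStronglyMeasurable ψ μ := aestronglyMeasurable_of_tendsto_ae _ hm hlim
  have hψC : ∀ᵐ x ∂μ, ‖ψ x‖ ≤ C := by
    filter_upwards [ae_all_iff.2 hC, hlim] with x h1 h2
    exact le_of_tendsto' h2.norm h1
  have hψ : MemLp ψ 2 μ := MemLp.of_bound hψm C hψC
  have hui : UnifIntegrable φ 2 μ := by
    -- Above this threshold the truncated functions vanish almost everywhere.
    refine unifIntegrable_of (by norm_num) (by norm_num) hm fun ε _ => ⟨C.toNNReal + 1, fun n => ?_⟩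
    have h0 : ({x | C.toNNReal + 1 ≤ ‖φ n x‖₊}.indicator (φ n)) =ᵐ[μ] 0 := by
      filter_upwards [hC n] with x hx
      refine Set.indicator_of_notMem (fun h => ?_) _
      have h1 : ((C.toNNReal + 1 : NNReal) : ℝ) ≤ ‖φ n x‖ := h
      have h2 := Real.le_coe_toNNReal C
      push_cast at h1
      linarith
    rw [eLpNorm_congr_ae h0, eLpNorm_zero]
    exact zero_le
  have ht := tendsto_Lp_finite_of_tendsto_ae (by norm_num) (by norm_num) hm hψ hui hlim
  have hφ2 : ∀ n, MemLp (φ n) 2 μ := fun n => MemLp.of_bound (hm n) C (hC n)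
  have ht2 := (Lp.tendsto_Lp_iff_tendsto_eLpNorm'' φ hφ2 ψ hψ).2 ht
  refine ⟨hψ.toLp ψ, hS.mem_of_tendsto ht2 (.of_forall fun n => ?_), hψ.coeFn_toLp⟩
  exact (hφ n).mem_of_ae_eq (hφ2 n).coeFn_toLp

end Represents

end Represented

/-! ### From an invariant algebra of functions to an invariant σ-algebra. -/

section InvariantAlgebra

variable {Γ : Type*} [Group Γ]
  {X : Type*} [MeasurableSpace X] [MulAction Γ X] [MeasurableConstSMul Γ X]
  {μ : Measure X} [SMulInvariantMeasure Γ X μ] [IsFiniteMeasure μ]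

variable (Γ) in
/-- A closed subspace of `L²` that contains `1`, whose bounded elements form a `*`-algebra that acts
on it, and that is invariant under the action of `Γ`. -/
structure IsInvariantAlgebra (S : Submodule ℂ (Lp ℂ 2 μ)) : Prop where
  isClosed : IsClosed (S : Set (Lp ℂ 2 μ))
  one_mem : oneTwo μ ∈ S
  mul_mem : ∀ f : Lp ℂ ∞ μ, toTwo f ∈ S → ∀ v ∈ S, multiplicationOperator f v ∈ S
  star_mem : ∀ f : Lp ℂ ∞ μ, toTwo f ∈ S → toTwo (star f) ∈ S
  koopman_mem : ∀ (s : Γ), ∀ v ∈ S, koopman μ s v ∈ S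

namespace IsInvariantAlgebra

variable {S : Submodule ℂ (Lp ℂ 2 μ)}

theorem represents_const (hS : IsInvariantAlgebra Γ S) (c : ℂ) : Represents S (fun _ => c) :=
  (Represents.const_mul c ⟨_, hS.one_mem, coeFn_oneTwo⟩).congr
    (.of_forall fun _ => mul_one c)

theorem represents_mul (hS : IsInvariantAlgebra Γ S) {φ ψ : X → ℂ} (hφ : Represents S φ)
    (hψ : Represents S ψ) {C : ℝ} (hC : ∀ᵐ x ∂μ, ‖φ x‖ ≤ C) :
    Represents S (fun x => φ x * ψ x) := by
  obtain ⟨f, hf⟩ := exists_ae_eq_of_bound hφ.aestronglyMeasurable hC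
  obtain ⟨w, hw, hwψ⟩ := hψ
  refine ⟨multiplicationOperator f w,
    hS.mul_mem f (hφ.mem_of_ae_eq ((coeFn_toTwo f).trans hf)) w hw, ?_⟩
  filter_upwards [coeFn_multiplicationOperator f w, hf, hwψ] with x h1 h2 h3
  rw [h1, h2, h3]

theorem represents_smul (hS : IsInvariantAlgebra Γ S) (s : Γ) {φ : X → ℂ} (hφ : Represents S φ) :
    Represents S (fun x => φ (s • x)) := by
  obtain ⟨v, hv, hvφ⟩ := hφ
  refine ⟨koopman μ s⁻¹ v, hS.koopman_mem s⁻¹ v hv, ?_⟩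
  filter_upwards [coeFn_koopman s⁻¹ v, ae_smul s hvφ] with x h1 h2
  rw [h1, inv_inv, h2]

/-- The sign of a bounded function in an invariant algebra is in the algebra. -/
theorem represents_sign (hS : IsInvariantAlgebra Γ S) {y : X → ℝ} (hy1 : ∀ᵐ x ∂μ, |y x| ≤ 1)
    (hy : Represents S (fun x => (y x : ℂ))) : Represents S (fun x => (Real.sign (y x) : ℂ)) := by
  have hb : ∀ n, ∀ᵐ x ∂μ, ‖((signStep^[n] (y x) : ℝ) : ℂ)‖ ≤ 1 := fun n => by
    filter_upwards [hy1] with x hx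
    rw [Complex.norm_real]
    exact abs_iterate_signStep_le_one hx n
  refine Represents.of_tendsto hS.isClosed (φ := fun n x => ((signStep^[n] (y x) : ℝ) : ℂ))
    (C := 1) (fun n => ?_) hb ?_
  · induction n with
    | zero => exact hy
    | succ n ih =>
      have h2 := hS.represents_mul ih ih (hb n)
      have h3 := hS.represents_mul ih h2 (hb n)
      refine ((ih.const_mul (3 / 2)).sub (h3.const_mul (1 / 2))).congr (.of_forall fun x => ?_)
      simp only [Function.iterate_succ_apply', signStep]
      push_cast
      rfl
  · filter_upwards [hy1] with x hx
    exact (Complex.continuous_ofReal.tendsto _).comp (tendsto_iterate_signStep hx)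

theorem represents_indicator_pos (hS : IsInvariantAlgebra Γ S) {y : X → ℝ}
    (hy1 : ∀ᵐ x ∂μ, |y x| ≤ 1) (hy : Represents S (fun x => (y x : ℂ))) :
    Represents S ({x | 0 < y x}.indicator fun _ => (1 : ℂ)) := by
  have h1 := hS.represents_sign hy1 hy
  have hb : ∀ᵐ x ∂μ, ‖(Real.sign (y x) : ℂ)‖ ≤ 1 := .of_forall fun x => by
    rcases Real.sign_apply_eq (y x) with h | h | h <;> simp [h]
  -- The indicator of {y > 0} is (sign y + (sign y)²)/2, which also gives 0 where y = 0.
  refine ((h1.add (hS.represents_mul h1 h1 hb)).const_mul (1 / 2)).congr (.of_forall fun x => ?_)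
  by_cases h : 0 < y x
  · rw [Set.indicator_of_mem (show x ∈ {x | 0 < y x} from h)]
    simp only [Real.sign_of_pos h]
    norm_num
  · rw [Set.indicator_of_notMem (show x ∉ {x | 0 < y x} from h)]
    rcases (not_lt.1 h).lt_or_eq with h | h
    · simp only [Real.sign_of_neg h]
      norm_num
    · simp [h]

theorem represents_indicator_union (hS : IsInvariantAlgebra Γ S) {E F : Set X}
    (hE : Represents S (E.indicator fun _ => (1 : ℂ)))
    (hF : Represents S (F.indicator fun _ => (1 : ℂ))) :
    Represents S ((E ∪ F).indicator fun _ => (1 : ℂ)) := by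
  classical
  refine ((hE.add hF).sub (hS.represents_mul hE hF (C := 1) (.of_forall fun x =>
    (norm_indicator_le_norm_self _ _).trans (by simp)))).congr (.of_forall fun x => ?_)
  simp only [Set.indicator_apply, Set.mem_union]
  by_cases h1 : x ∈ E <;> by_cases h2 : x ∈ F <;> simp [h1, h2]

/-- The `σ`-algebra of the measurable sets whose indicator function is in the algebra. -/
abbrev sigmaAlgebra (hS : IsInvariantAlgebra Γ S) : MeasurableSpace X where
  MeasurableSet' E := MeasurableSet E ∧ Represents S (E.indicator fun _ => (1 : ℂ))
  measurableSet_empty := ⟨.empty, by simpa using hS.represents_const 0⟩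
  measurableSet_compl E hE := by
    classical
    refine ⟨hE.1.compl, ((hS.represents_const 1).sub hE.2).congr (.of_forall fun x => ?_)⟩
    by_cases h : x ∈ E <;> simp [h]
  measurableSet_iUnion f hf := by
    classical
    refine ⟨.iUnion fun i => (hf i).1, ?_⟩
    refine Represents.of_tendsto hS.isClosed (C := 1)
      (φ := fun n => (⋃ i ∈ Finset.range n, f i).indicator fun _ => (1 : ℂ)) (fun n => ?_)
      (fun n => .of_forall fun x => (norm_indicator_le_norm_self _ _).trans (by simp))
      (.of_forall fun x => ?_)
    · induction n with
      | zero => simpa using hS.represents_const 0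
      | succ n ih =>
        rw [Finset.range_add_one, Finset.set_biUnion_insert]
        exact hS.represents_indicator_union (hf n).2 ih
    · have h := (tendsto_indicator_biUnion_finset f (fun _ => (1 : ℂ)) x).comp
        Filter.tendsto_finset_range
      exact h.mono_right (pure_le_nhds _)

theorem measurable_sigmaAlgebra_of_real (hS : IsInvariantAlgebra Γ S) {φ : X → ℝ} (hφ : Measurable φ) {C : ℝ}
    (hC : ∀ᵐ x ∂μ, |φ x| ≤ C) (h : Represents S (fun x => (φ x : ℂ))) :
    @Measurable _ _ hS.sigmaAlgebra _ φ := by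
  refine @measurable_of_Ioi ℝ X _ _ _ hS.sigmaAlgebra _ _ _ φ fun c => ?_
  refine ⟨hφ measurableSet_Ioi, ?_⟩
  -- Dividing φ - c by D keeps the set {φ > c} and brings the values into [-1, 1], where the sign
  -- iteration converges.
  set D : ℝ := |C| + |c| + 1
  have hD : 0 < D := by positivity
  have h1 := hS.represents_indicator_pos (y := fun x => D⁻¹ * (φ x - c)) ?_ ?_
  · convert h1 using 2
    ext x
    simp only [Set.mem_preimage, Set.mem_Ioi, Set.mem_ofPred_eq]
    rw [mul_pos_iff_of_pos_left (by positivity), sub_pos]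
  · filter_upwards [hC] with x hx
    rw [abs_mul, abs_of_pos (by positivity), inv_mul_le_iff₀ hD, mul_one]
    have := abs_sub (φ x) c
    have := le_abs_self C
    linarith
  · refine ((h.sub (hS.represents_const c)).const_mul (D⁻¹ : ℝ)).congr (.of_forall fun x => ?_)
    push_cast
    rfl

/-- The bounded functions in the algebra are measurable for its `σ`-algebra. -/
theorem measurable_sigmaAlgebra (hS : IsInvariantAlgebra Γ S) {f : Lp ℂ ∞ μ} (hf : toTwo f ∈ S) :
    @Measurable _ _ hS.sigmaAlgebra _ f := by
  have hm : Measurable f := (Lp.stronglyMeasurable f).measurable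
  have hb := ae_norm_le_norm f
  have h1 : Represents S f := ⟨_, hf, coeFn_toTwo f⟩
  have h2 : Represents S (fun x => star (f x)) :=
    ⟨_, hS.star_mem f hf, (coeFn_toTwo (star f)).trans (Lp.coeFn_star f)⟩
  refine @measurable_of_re_im _ _ _ hS.sigmaAlgebra _ ?_ ?_
  · refine hS.measurable_sigmaAlgebra_of_real (Complex.measurable_re.comp hm) (C := ‖f‖) ?_ ?_
    · filter_upwards [hb] with x hx using (Complex.abs_re_le_norm _).trans hx
    · refine ((h1.add h2).const_mul (1 / 2)).congr (.of_forall fun x => ?_)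
      apply Complex.ext
      · simp; ring
      · simp
  · refine hS.measurable_sigmaAlgebra_of_real (Complex.measurable_im.comp hm) (C := ‖f‖) ?_ ?_
    · filter_upwards [hb] with x hx using (Complex.abs_im_le_norm _).trans hx
    · refine ((h1.sub h2).const_mul (-Complex.I / 2)).congr (.of_forall fun x => ?_)
      apply Complex.ext
      · simp; ring
      · simp

theorem measurable_smul_sigmaAlgebra (hS : IsInvariantAlgebra Γ S) (s : Γ) :
    @Measurable _ _ hS.sigmaAlgebra hS.sigmaAlgebra (fun x : X => s • x) := by
  intro E hE
  exact ⟨measurable_const_smul s hE.1, hS.represents_smul s hE.2⟩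

end IsInvariantAlgebra

end InvariantAlgebra

/-! ### The shift space of functions on ℕ × Γ and the factor generated by a sequence of functions.
-/

section Coding

variable (Γ : Type*) [Group Γ] [Countable Γ]

/-- The space of sequences of complex functions on `Γ`, in the lowest universe. -/
def CodingSpace : Type := ℕ → Shrink.{0} Γ → ℂ

instance : MeasurableSpace (CodingSpace Γ) :=
  inferInstanceAs (MeasurableSpace (ℕ → Shrink.{0} Γ → ℂ))

instance : StandardBorelSpace (CodingSpace Γ) := by
  have : Countable (Shrink.{0} Γ) := (equivShrink.{0} Γ).symm.injective.countable
  exact inferInstanceAs (StandardBorelSpace (ℕ → Shrink.{0} Γ → ℂ))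

/-- The shift action of `Γ` on the coding space. -/
instance : MulAction Γ (CodingSpace Γ) where
  -- Right translation of the argument is a left action, and makes the orbit reading r ↦ f(r x)
  -- equivariant.
  smul s y := fun n r => y n (equivShrink.{0} Γ ((equivShrink.{0} Γ).symm r * s))
  one_smul y := by
    change (fun n r => y n (equivShrink.{0} Γ ((equivShrink.{0} Γ).symm r * 1))) = y
    simp
  mul_smul s t y := by
    change (fun n r => y n (equivShrink.{0} Γ ((equivShrink.{0} Γ).symm r * (s * t)))) =
      fun n r => y n (equivShrink.{0} Γ ((equivShrink.{0} Γ).symm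
        (equivShrink.{0} Γ ((equivShrink.{0} Γ).symm r * s)) * t))
    simp [mul_assoc]

variable {Γ}

theorem CodingSpace.measurable_iff {Z : Type*} [MeasurableSpace Z] {φ : Z → CodingSpace Γ} :
    Measurable φ ↔ ∀ n r, Measurable fun z => φ z n r := by
  unfold CodingSpace at φ ⊢
  constructor
  · intro h n r
    exact measurable_pi_iff.1 (measurable_pi_iff.1 h n) r
  · intro h
    exact measurable_pi_iff.2 fun n => measurable_pi_iff.2 fun r => h n r

theorem CodingSpace.measurable_apply (n : ℕ) (r : Shrink.{0} Γ) :
    Measurable fun y : CodingSpace Γ => y n r :=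
  CodingSpace.measurable_iff.1 measurable_id n r

instance : MeasurableConstSMul Γ (CodingSpace Γ) where
  measurable_const_smul _ := CodingSpace.measurable_iff.2 fun n _ =>
    CodingSpace.measurable_apply n _

variable {X : Type*} [MulAction Γ X]

/-- The equivariant map to the coding space given by a sequence of functions. -/
def codingMap (f : ℕ → X → ℂ) (x : X) : CodingSpace Γ :=
  fun n r => f n ((equivShrink.{0} Γ).symm r • x)

theorem codingMap_smul (f : ℕ → X → ℂ) (s : Γ) (x : X) :
    codingMap (Γ := Γ) f (s • x) = s • codingMap f x := by
  change (fun n r => f n ((equivShrink.{0} Γ).symm r • s • x)) =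
    fun n r => f n ((equivShrink.{0} Γ).symm (equivShrink.{0} Γ ((equivShrink.{0} Γ).symm r * s)) • x)
  simp [mul_smul]

theorem measurable_codingMap [MeasurableSpace X] {f : ℕ → X → ℂ} (hf : ∀ n, Measurable (f n))
    (hsmul : ∀ s : Γ, Measurable fun x : X => s • x) : Measurable (codingMap (Γ := Γ) f) :=
  CodingSpace.measurable_iff.2 fun n _ => (hf n).comp (hsmul _)

variable [MeasurableSpace X] [MeasurableConstSMul Γ X]

/-- The factor generated by a sequence of functions. -/
def codingFactor (μ : Measure X) [IsProbabilityMeasure μ] [SMulInvariantMeasure Γ X μ]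
    {f : ℕ → X → ℂ} (hf : ∀ n, Measurable (f n)) : MeasurableFactor Γ μ (CodingSpace Γ) where
  standardBorel := inferInstance
  action := inferInstance
  measurable_action := inferInstance
  η := μ.map (codingMap f)
  isProbabilityMeasure := Measure.isProbabilityMeasure_map
    (measurable_codingMap hf fun s => measurable_const_smul s).aemeasurable
  invariant := ⟨fun s E hE => by
    have hm : Measurable (codingMap (Γ := Γ) f) :=
      measurable_codingMap hf fun s => measurable_const_smul s
    rw [Measure.map_apply hm (measurable_const_smul s hE), Measure.map_apply hm hE,
      ← measure_preimage_smul μ s (codingMap f ⁻¹' E)]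
    congr 1
    ext x
    simp only [Set.mem_preimage, codingMap_smul]⟩
  π := codingMap f
  measurePreserving := ⟨measurable_codingMap hf fun s => measurable_const_smul s, rfl⟩
  equivariant s := .of_forall fun x => codingMap_smul f s x

end Coding

/-! ### Every invariant algebra comes from a factor. -/

section Factor

variable {Γ : Type*} [Group Γ]
  {X : Type*} [MeasurableSpace X] [MulAction Γ X] [MeasurableConstSMul Γ X]
  {μ : Measure X} [IsProbabilityMeasure μ] [SMulInvariantMeasure Γ X μ]
  {S : Submodule ℂ (Lp ℂ 2 μ)}

/-- If the factor map is measurable for the `σ`-algebra of an invariant algebra, then the functions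
that come from the factor are in the algebra. -/
theorem IsInvariantAlgebra.toTwo_comp_mem (hS : IsInvariantAlgebra Γ S) {Y : Type*}
    [MeasurableSpace Y] {η : Measure Y} [IsProbabilityMeasure η] {p : X → Y}
    (hp : MeasurePreserving p μ η) (hpm : @Measurable _ _ hS.sigmaAlgebra _ p) (g : Lp ℂ ∞ η) :
    toTwo (Lp.compMeasurePreserving p hp g) ∈ S := by
  have key : ∀ ⦃g : Y → ℂ⦄, MemLp g 2 η → Represents S (g ∘ p) := by
    -- Indicators pull back into S by the definition of the σ-algebra, and closedness of S handles
    -- the limits.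
    refine MemLp.induction (p := 2) (by norm_num) (fun g : Y → ℂ => Represents S (g ∘ p)) ?_ ?_ ?_ ?_
    · intro c s hs _
      refine ((hpm hs).2.const_mul c).congr (.of_forall fun x => ?_)
      by_cases h : p x ∈ s <;> simp [Set.indicator, h]
    · intro f g _ _ _ hf hg
      exact hf.add hg
    · have h : {f : Lp ℂ 2 η | Represents S (f ∘ p)} =
          Lp.compMeasurePreserving p hp ⁻¹' (S : Set (Lp ℂ 2 μ)) := by
        ext f
        have h1 := Lp.coeFn_compMeasurePreserving f hp
        exact ⟨fun h => h.mem_of_ae_eq h1, fun h => ⟨_, h, h1⟩⟩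
      rw [h]
      exact hS.isClosed.preimage (Lp.isometry_compMeasurePreserving hp).continuous
    · intro f g hfg _ hf
      exact hf.congr (hp.quasiMeasurePreserving.ae_eq_comp hfg)
  have hg : MemLp g 2 η := (Lp.memLp g).mono_exponent le_top
  exact (key hg).mem_of_ae_eq ((coeFn_toTwo _).trans (Lp.coeFn_compMeasurePreserving g hp))

/-- An invariant algebra comes from a factor. -/
theorem IsInvariantAlgebra.exists_factor [Countable Γ] [StandardBorelSpace X]
    (hS : IsInvariantAlgebra Γ S) :
    ∃ F : MeasurableFactor Γ μ (CodingSpace Γ),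
      (∀ g : Lp ℂ ∞ F.η, toTwo (Lp.compMeasurePreserving F.π F.measurePreserving g) ∈ S) ∧
      ∀ f : Lp ℂ ∞ μ, toTwo f ∈ S → toTwo f ∈ closure (Set.range fun g : Lp ℂ ∞ F.η =>
        toTwo (Lp.compMeasurePreserving F.π F.measurePreserving g)) := by
  -- The dense sequence is taken among the bounded elements, so that its terms are measurable for
  -- the σ-algebra of S and come from L^∞(Y).
  let D : Set (Lp ℂ 2 μ) := {v | v ∈ S ∧ ∃ f : Lp ℂ ∞ μ, toTwo f = v}
  have : Nonempty D := ⟨⟨oneTwo μ, hS.one_mem, oneTop μ, toTwo_oneTop⟩⟩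
  -- Finiteness of the exponent, together with X being standard Borel, makes L² separable.
  have : Fact ((2 : ℝ≥0∞) ≠ ∞) := ⟨by norm_num⟩
  obtain ⟨u, hu⟩ := TopologicalSpace.exists_dense_seq D
  choose f hf using fun n => (u n).2.2
  have hfS : ∀ n, toTwo (f n) ∈ S := fun n => by rw [hf]; exact (u n).2.1
  have hfm : ∀ n, Measurable (f n) := fun n => (Lp.stronglyMeasurable (f n)).measurable
  refine ⟨codingFactor μ hfm, fun g => ?_, fun h hh => ?_⟩
  · have := (codingFactor (Γ := Γ) μ hfm).isProbabilityMeasure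
    refine hS.toTwo_comp_mem _ ?_ g
    exact @measurable_codingMap Γ _ _ X _ hS.sigmaAlgebra (fun n => f n)
      (fun n => hS.measurable_sigmaAlgebra (hfS n)) hS.measurable_smul_sigmaAlgebra
  · have h1 : toTwo h ∈ closure (Set.range fun n => (u n : Lp ℂ 2 μ)) := by
      have h2 : (⟨toTwo h, hh, h, rfl⟩ : D) ∈ closure (Set.range u) := hu _
      have h3 := image_closure_subset_closure_image continuous_subtype_val
        (Set.mem_image_of_mem Subtype.val h2)
      rwa [← Set.range_comp] at h3
    refine closure_mono ?_ h1
    rintro _ ⟨n, rfl⟩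
    set F := codingFactor (Γ := Γ) μ hfm
    -- The coordinate (n, e) of the coding map is f n itself, so f n factors through the coding map.
    have hm : Measurable fun y : CodingSpace Γ => y n (equivShrink.{0} Γ 1) :=
      CodingSpace.measurable_apply n _
    have hcoord : ∀ x, F.π x n (equivShrink.{0} Γ 1) = f n x := fun x => by
      change f n ((equivShrink.{0} Γ).symm (equivShrink.{0} Γ 1) • x) = f n x
      simp
    obtain ⟨g, hg⟩ := exists_ae_eq_of_bound (μ := F.η) (C := ‖f n‖) hm.aestronglyMeasurable (by
      rw [← F.measurePreserving.map_eq, ae_map_iff F.measurePreserving.measurable.aemeasurable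
        (measurableSet_le hm.norm measurable_const)]
      filter_upwards [ae_norm_le_norm (f n)] with x hx
      rwa [hcoord])
    have := F.isProbabilityMeasure
    refine ⟨g, (Lp.ext ?_).trans (hf n)⟩
    filter_upwards [coeFn_toTwo (f n),
      coeFn_toTwo (Lp.compMeasurePreserving F.π F.measurePreserving g),
      Lp.coeFn_compMeasurePreserving g F.measurePreserving,
      F.measurePreserving.quasiMeasurePreserving.ae_eq_comp hg] with x h1 h2 h3 h4
    rw [h1, h2, h3, h4, Function.comp_apply, hcoord]

end Factor

/-! ### Reconstructing an element from its Fourier coefficients. -/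

section Reflecting

variable {Γ : Type*} [Group Γ]
  {X : Type*} [MeasurableSpace X] [MulAction Γ X] [MeasurableConstSMul Γ X]
  {μ : Measure X} [SMulInvariantMeasure Γ X μ]

theorem isInvariantAlgebra_coefficientSpace [IsFiniteMeasure μ]
    {A : VonNeumannAlgebra (EllTwo Γ (Lp ℂ 2 μ))} (hA : A ≤ crossedProduct Γ μ)
    (hG : groupVonNeumann Γ (Lp ℂ 2 μ) ≤ A) : IsInvariantAlgebra Γ (coefficientSpace A) where
  isClosed := isClosed_coefficientSpace A
  one_mem := oneTwo_mem_coefficientSpace A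
  mul_mem _ hf _ hv := multiplicationOperator_mem_coefficientSpace ((linftyRep_mem_iff hA).2 hf) hv
  star_mem _ hf := by
    rw [← linftyRep_mem_iff hA, ← star_linftyRep]
    exact star_mem ((linftyRep_mem_iff hA).2 hf)
  koopman_mem s _ hv := koopman_mem_coefficientSpace hA hG s hv

/-- A von Neumann subalgebra `N` of the crossed product that contains `L(Γ)` contains the elements
of the crossed product all of whose coefficients are in the coefficient space of `N`. -/
theorem mem_of_coefficients_mem [IsFiniteMeasure μ]
    {N : VonNeumannAlgebra (EllTwo Γ (Lp ℂ 2 μ))} (hN : N ≤ crossedProduct Γ μ)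
    (hG : groupVonNeumann Γ (Lp ℂ 2 μ) ≤ N)
    {a : EllTwo Γ (Lp ℂ 2 μ) →L[ℂ] EllTwo Γ (Lp ℂ 2 μ)} (ha : a ∈ crossedProduct Γ μ)
    (h : ∀ t, koopman μ t (a (traceVector Γ μ) t) ∈ coefficientSpace N) : a ∈ N := by
  refine mem_of_apply_mem_orbitClosure hN ha ?_
  refine (isClosed_orbitClosure N).mem_of_tendsto (hasSum_delta (a (traceVector Γ μ)))
    (.of_forall fun T => Submodule.sum_mem _ fun t _ => ?_)
  -- This operator sends nΩ to nλ(t)Ω, so it preserves the closure of NΩ, and it takes δ_e ⊗ u_t v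
  -- to δ_t ⊗ v.
  have h1 := map_mem_of_mem_orbitClosure (isClosed_orbitClosure N) (rightOp t (oneTop μ))
    (fun n hn => ?_) (mem_coefficientSpace.1 (h t))
  · rwa [rightOp_delta, multiplicationOperator_oneTop, koopman_koopman, inv_mul_cancel,
      koopman_one, one_mul] at h1
  · have h2 := apply_mem_orbitClosure (mul_mem hn (hG (leftTranslation_mem_groupVonNeumann t)))
    rwa [mul_apply_eq_comp, leftTranslation_traceVector, ← toTwo_oneTop,
      apply_delta_toTwo (hN hn)] at h2

/-- Every Fourier coefficient of a is the identity coefficient of some aλ(t)⁻¹, so results on the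
identity coefficient cover all of them. -/
theorem koopman_apply_traceVector [IsFiniteMeasure μ]
    {a : EllTwo Γ (Lp ℂ 2 μ) →L[ℂ] EllTwo Γ (Lp ℂ 2 μ)} (ha : a ∈ crossedProduct Γ μ) (t : Γ) :
    koopman μ t (a (traceVector Γ μ) t) =
      (a * leftTranslation (Lp ℂ 2 μ) t⁻¹) (traceVector Γ μ) 1 := by
  rw [mul_apply_eq_comp, leftTranslation_traceVector, ← toTwo_oneTop, apply_delta_toTwo ha,
    rightOp_apply, multiplicationOperator_oneTop, inv_inv, one_mul]

end Reflecting
end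

theorem theorem3p5 {Γ : Type*} [Group Γ] [Countable Γ]
    {X : Type*} [MeasurableSpace X] [StandardBorelSpace X]
    [MulAction Γ X] [MeasurableConstSMul Γ X]
    (μ : Measure X) [IsProbabilityMeasure μ] [SMulInvariantMeasure Γ X μ]
    (hplump : ∀ (f : Lp ℂ ∞ μ) (ε : ℝ), 0 < ε → IsPlump (almostInvariantSet Γ f ε)) :
    IsReflecting Γ μ := by
  intro A hG hA
  obtain ⟨F, hF, hdense⟩ := (isInvariantAlgebra_coefficientSpace hA hG).exists_factor
  refine ⟨CodingSpace Γ, inferInstance, F, ?_⟩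
  have hFA : F.crossedProduct ≤ A := by
    refine vonNeumannGenerated_le ?_
    rintro _ (⟨g, rfl⟩ | ⟨s, rfl⟩)
    · exact (linftyRep_mem_iff hA).2 (hF g)
    · exact hG (leftTranslation_mem_groupVonNeumann s)
  have hGF : groupVonNeumann Γ (Lp ℂ 2 μ) ≤ F.crossedProduct := by
    refine vonNeumannGenerated_le fun a ha => ?_
    exact subset_vonNeumannGenerated (Or.inr ha)
  refine le_antisymm (fun a ha => ?_) hFA
  refine mem_of_coefficients_mem (hFA.trans hA) hGF (hA ha) fun t => ?_
  have hat : a * leftTranslation (Lp ℂ 2 μ) t⁻¹ ∈ A :=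
    mul_mem ha (hG (leftTranslation_mem_groupVonNeumann t⁻¹))
  rw [koopman_apply_traceVector (hA ha)]
  have h1 := apply_traceVector_one_mem_coefficientSpace hplump hA hG hat
  -- Approximation by functions from the factor is available for bounded elements of the coefficient
  -- space, so the coefficient has to be recognised as an element of L^∞.
  obtain ⟨f, hf⟩ := exists_toTwo_eq_apply_traceVector (hA hat)
  rw [← hf] at h1 ⊢
  refine closure_minimal ?_ (isClosed_coefficientSpace F.crossedProduct) (hdense f h1)
  rintro _ ⟨g, rfl⟩
  exact (linftyRep_mem_iff (hFA.trans hA)).1 (subset_vonNeumannGenerated (Or.inl ⟨g, rfl⟩))
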